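/- Consider the control-affine system $\dot x = f(x)+g(x)u$ with $x\in\mathbb{R}^n$, $u\in\mathbb{R}^m$ and $f:\mathbb{R}^n\to\mathbb{R}^n$, $g:\mathbb{R}^n\to\mathbb{R}^{n\times m}$ locally Lipschitz. Write $L_fh=\nabla h^{T}f$ and $L_gh=\nabla h^{T}g$. Assume the following. (a) $\mathcal{E}\subseteq\mathbb{R}^n$ is open and $h:\mathcal{E}\to\mathbb{R}$ is a continuously differentiable zeroing control barrier function: there is a given locally Lipschitz, strictly increasing $\alpha:\mathbb{R}\to\mathbb{R}$ with $\alpha(0)=0$ such that $\sup_{u\in\mathbb{R}^m}[L_fh(x)+L_gh(x)u+\alpha(h(x))]\ge 0$ for all $x\in\mathcal{E}$. Put $\mathcal{C}=\{x\in\mathcal{E}:h(x)\ge 0\}$ and $\mathrm{Int}(\mathcal{C})=\{x\in\mathcal{E}:h(x)>0\}$, and suppose $0\in\mathrm{Int}(\mathcal{C})$. (b) $\mathcal{D}\subseteq\mathbb{R}^n$ is open, $0\in\mathcal{D}$, $k:\mathcal{D}\to\mathbb{R}^m$ is locally Lipschitz with $f(0)+g(0)k(0)=0$, and $V:\mathcal{D}\to\mathbb{R}$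 is continuously differentiable with $V(0)=0$ and $V(x)>0$ for $x\ne 0$. With $\dot V_k(x):=\nabla V(x)^{T}(f(x)+g(x)k(x))$, either $\dot V_k(x)<0$ for all $x\in\mathcal{D}\setminus\{0\}$; or $\dot V_k\le 0$ on $\mathcal{D}$ and no solution of $\dot x=f(x)+g(x)k(x)$ other than $x(t)\equiv 0$ stays in $\{x\in\mathcal{D}:\dot V_k(x)=0\}$ for all $t\ge 0$ (LaSalle's condition). (c) $G(x)\in\mathbb{R}^{m\times m}$ is symmetric positive definite and locally Lipschitz on $\mathcal{D}\cap\mathcal{E}$, $\nu>0$, and $\Gamma_\nu=\{x\in\mathcal{D}:V(x)\le\nu\}$ is CBF-stabilizable: there is $\mathcal{A}\subseteq\Gamma_\nu\cap\mathcal{C}$ such that $\nabla V(x)^{T}g(x)G(x)^{-1}g(x)^{T}\nabla h(x)<0$ on $(\Gamma_\nu\cap\mathcal{C})\setminus\mathcal{A}$, and $L_fh(x)+L_gh(x)k(x)+\alpha(h(x))\ge 0$ on $\mathcal{A}$. (d) Either $L_gh(x)\neq 0$ for all $x\in\Gamma_\nu\cap\mathcal{E}$; or every $x\in\Gamma_\nu\cap\mathcal{E}$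 with $L_gh(x)=0$ satisfies $x\in\mathrm{Int}(\mathcal{C})$ and $\nabla h(x)=0$. Then for every $x\in\mathcal{D}\cap\mathcal{E}$ the quadratic program $$u^*(x)=\operatorname*{argmin}_{u\in\mathbb{R}^m}\ \tfrac12 (u-k(x))^{T}G(x)(u-k(x))\quad\text{s.t.}\quad L_fh(x)+L_gh(x)u\ge-\alpha(h(x))$$ has exactly one solution, and the closed loop $\dot x=f(x)+g(x)u^*(x)$ on $\mathcal{D}\cap\mathcal{E}$ satisfies: 1. Let $x_0\in\Gamma_\nu\cap\mathcal{C}$, where, if $V(x_0)=\nu$, we also suppose $\dot V_k(x_0)<0$. Then every solution with $x(0)=x_0$ stays in $\Gamma_\nu\cap\mathcal{C}$ as long as it exists. If moreover $\Gamma_\nu\cap\mathcal{C}$ is compact, then a solution from $x_0$ exists for all $t\ge 0$, every solution from $x_0$ on a bounded interval $[0,T)$ extends to all $t\ge0$, and every solution from $x_0$ satisfies $x(t)\in\Gamma_\nu\cap\mathcal{C}$ for all $t\ge 0$. 2. The origin is an asymptotically stable equilibrium of the closed loop (Lyapunov stable and locally attractive, with solutions from nearby points existing for all $t\ge 0$).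 If moreover $\Gamma_\nu\cap\mathcal{C}$ is compact, then every solution from an $x_0$ as in 1 converges to the origin. -/

import Mathlib

open Set Filter Topology
open scoped Matrix

noncomputable section

/-- A control-affine system `ẋ = f(x) + g(x) u` on `ℝⁿ` with input `u ∈ ℝᵐ` and locally Lipschitz
`f`, `g` (for the matrix-valued `g` this is stated entrywise). -/
structure ControlAffineSystem (n m : ℕ) where
  f : EuclideanSpace ℝ (Fin n) → EuclideanSpace ℝ (Fin n)
  g : EuclideanSpace ℝ (Fin n) → Matrix (Fin n) (Fin m) ℝ
  lipschitz_f : LocallyLipschitz f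
  lipschitz_g : ∀ i j, LocallyLipschitz fun x => g x i j

namespace ControlAffineSystem

variable {n m : ℕ} (S : ControlAffineSystem n m)

/-- The right-hand side `f(x) + g(x) u`. -/
def rhs (x : EuclideanSpace ℝ (Fin n)) (u : EuclideanSpace ℝ (Fin m)) :
    EuclideanSpace ℝ (Fin n) :=
  S.f x + WithLp.toLp 2 (S.g x *ᵥ u.ofLp)

/-- The vector field `x ↦ f(x) + g(x) k(x)` of the loop closed with the feedback `k`. -/
def closedLoop (k : EuclideanSpace ℝ (Fin n) → EuclideanSpace ℝ (Fin m))
    (x : EuclideanSpace ℝ (Fin n)) : EuclideanSpace ℝ (Fin n) :=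
  S.rhs x (k x)

/-- The Lie derivative `L_f h(x) = ∇h(x)ᵀ f(x)`. -/
def lieF (h : EuclideanSpace ℝ (Fin n) → ℝ) (x : EuclideanSpace ℝ (Fin n)) : ℝ :=
  inner ℝ (gradient h x) (S.f x)

/-- The Lie derivative `L_g h(x) = ∇h(x)ᵀ g(x)`, a row vector of length `m`. -/
def lieG (h : EuclideanSpace ℝ (Fin n) → ℝ) (x : EuclideanSpace ℝ (Fin n)) : Fin m → ℝ :=
  (gradient h x).ofLp ᵥ* S.g x

/-- The derivative `∇V(x)ᵀ (f(x) + g(x) k(x))` of `V` along the loop closed with `k`. -/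
def lieClosedLoop (V : EuclideanSpace ℝ (Fin n) → ℝ)
    (k : EuclideanSpace ℝ (Fin n) → EuclideanSpace ℝ (Fin m))
    (x : EuclideanSpace ℝ (Fin n)) : ℝ :=
  inner ℝ (gradient V x) (S.closedLoop k x)

end ControlAffineSystem

/-- `x` is a (classical) solution of `ẋ = F(x)` on the time set `I`, with values in `Ω`.
It is used with `I = [0, T)` and `I = [0, ∞)`; the derivative at `0` is the right derivative. -/
def IsSolutionOn {n : ℕ} (F : EuclideanSpace ℝ (Fin n) → EuclideanSpace ℝ (Fin n))
    (Ω : Set (EuclideanSpace ℝ (Fin n))) (I : Set ℝ) (x : ℝ → EuclideanSpace ℝ (Fin n)) : Prop :=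
  ∀ t ∈ I, x t ∈ Ω ∧ HasDerivWithinAt x (F (x t)) I t

/-- From `x₀` there is a solution of `ẋ = F(x)` in `Ω` for all `t ≥ 0`, and every solution on a
bounded interval `[0, T)` extends to one: all maximal solutions from `x₀` exist for all `t ≥ 0`. -/
def ForwardComplete {n : ℕ} (F : EuclideanSpace ℝ (Fin n) → EuclideanSpace ℝ (Fin n))
    (Ω : Set (EuclideanSpace ℝ (Fin n))) (x₀ : EuclideanSpace ℝ (Fin n)) : Prop :=
  (∃ x : ℝ → EuclideanSpace ℝ (Fin n), IsSolutionOn F Ω (Ici 0) x ∧ x 0 = x₀) ∧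
  ∀ T : ℝ, 0 < T → ∀ x : ℝ → EuclideanSpace ℝ (Fin n),
    IsSolutionOn F Ω (Ico 0 T) x → x 0 = x₀ →
    ∃ y : ℝ → EuclideanSpace ℝ (Fin n), IsSolutionOn F Ω (Ici 0) y ∧ EqOn x y (Ico 0 T)

/-- The origin is an asymptotically stable equilibrium of `ẋ = F(x)` on `Ω`: an equilibrium, stable
in the sense of Lyapunov, and attracting all solutions that start close enough to it. -/
structure IsAsymptoticallyStable {n : ℕ}
    (F : EuclideanSpace ℝ (Fin n) → EuclideanSpace ℝ (Fin n))
    (Ω : Set (EuclideanSpace ℝ (Fin n))) : Prop where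
  mem : (0 : EuclideanSpace ℝ (Fin n)) ∈ Ω
  equilibrium : F 0 = 0
  stable : ∀ ε > 0, ∃ δ > 0, ∀ x₀ : EuclideanSpace ℝ (Fin n), ‖x₀‖ < δ →
    ForwardComplete F Ω x₀ ∧
    ∀ x : ℝ → EuclideanSpace ℝ (Fin n), IsSolutionOn F Ω (Ici 0) x → x 0 = x₀ →
      ∀ t, 0 ≤ t → ‖x t‖ < ε
  attractive : ∃ δ > 0, ∀ x₀ : EuclideanSpace ℝ (Fin n), ‖x₀‖ < δ →
    ∀ x : ℝ → EuclideanSpace ℝ (Fin n), IsSolutionOn F Ω (Ici 0) x → x 0 = x₀ →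
      Tendsto x atTop (𝓝 0)

/-- Locally Lipschitz, extended class-`𝒦` functions. -/
structure IsExtendedClassK (α : ℝ → ℝ) : Prop where
  lipschitz : LocallyLipschitz α
  strictMono : StrictMono α
  map_zero : α 0 = 0

/-- The constraint set `𝒞 = {x : h(x) ≥ 0}` of a function `h : ℰ → ℝ`. -/
def constraintSet {n : ℕ} (E : Set (EuclideanSpace ℝ (Fin n)))
    (h : EuclideanSpace ℝ (Fin n) → ℝ) : Set (EuclideanSpace ℝ (Fin n)) :=
  {x ∈ E | 0 ≤ h x}

/-- The interior of the constraint set, in the usual convention for barrier functions: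
the set `{x : h(x) > 0}`. -/
def constraintInterior {n : ℕ} (E : Set (EuclideanSpace ℝ (Fin n)))
    (h : EuclideanSpace ℝ (Fin n) → ℝ) : Set (EuclideanSpace ℝ (Fin n)) :=
  {x ∈ E | 0 < h x}

/-- The sublevel set `Γ_ν = {x ∈ 𝒟 : V(x) ≤ ν}`. -/
def sublevel {n : ℕ} (D : Set (EuclideanSpace ℝ (Fin n)))
    (V : EuclideanSpace ℝ (Fin n) → ℝ) (ν : ℝ) : Set (EuclideanSpace ℝ (Fin n)) :=
  {x ∈ D | V x ≤ ν}

namespace ControlAffineSystem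

variable {n m : ℕ} (S : ControlAffineSystem n m)

/-- `h` is a continuously differentiable zeroing control barrier function on the open set `E`,
with extended class-`𝒦` function `α`. The supremum over `u ∈ ℝᵐ` is taken in `[-∞, ∞]`. -/
structure IsZCBF (E : Set (EuclideanSpace ℝ (Fin n))) (h : EuclideanSpace ℝ (Fin n) → ℝ)
    (α : ℝ → ℝ) : Prop where
  isOpen : IsOpen E
  contDiff : ContDiffOn ℝ 1 h E
  classK : IsExtendedClassK α
  barrier : ∀ x ∈ E, (0 : EReal) ≤ ⨆ u : EuclideanSpace ℝ (Fin m),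
    ((S.lieF h x + S.lieG h x ⬝ᵥ u.ofLp + α (h x) : ℝ) : EReal)

/-- The nominal feedback `k` with its Lyapunov function `V` on the open set `D`. Either `V` is
strictly decreasing along the nominal closed loop away from the origin, or it is non-increasing and
the condition of LaSalle's principle holds: only the trivial solution stays identically in the set
where the derivative of `V` along the nominal closed loop vanishes. -/
structure IsLyapunovStabilizing (D : Set (EuclideanSpace ℝ (Fin n)))
    (k : EuclideanSpace ℝ (Fin n) → EuclideanSpace ℝ (Fin m))
    (V : EuclideanSpace ℝ (Fin n) → ℝ) : Prop where
  isOpen : IsOpen D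
  zero_mem : (0 : EuclideanSpace ℝ (Fin n)) ∈ D
  lipschitz : LocallyLipschitzOn D k
  equilibrium : S.closedLoop k 0 = 0
  contDiff : ContDiffOn ℝ 1 V D
  map_zero : V 0 = 0
  pos : ∀ x ∈ D, x ≠ 0 → 0 < V x
  decrease :
    (∀ x ∈ D, x ≠ 0 → S.lieClosedLoop V k x < 0) ∨
    ((∀ x ∈ D, S.lieClosedLoop V k x ≤ 0) ∧
      ∀ x : ℝ → EuclideanSpace ℝ (Fin n),
        IsSolutionOn (S.closedLoop k) {y ∈ D | S.lieClosedLoop V k y = 0} (Ici 0) x →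
        ∀ t, 0 ≤ t → x t = 0)

/-- `z(x) = L_f h(x) + L_g h(x) k(x) + α(h(x))`. -/
def barrierMargin (h : EuclideanSpace ℝ (Fin n) → ℝ) (α : ℝ → ℝ)
    (k : EuclideanSpace ℝ (Fin n) → EuclideanSpace ℝ (Fin m))
    (x : EuclideanSpace ℝ (Fin n)) : ℝ :=
  S.lieF h x + S.lieG h x ⬝ᵥ (k x).ofLp + α (h x)

/-- `Γ_ν` is CBF-stabilizable with respect to the weight `G`: on `Γ_ν ∩ 𝒞`, outside a subset `A`
on which `z ≥ 0`, one has `∇V(x)ᵀ g(x) G(x)⁻¹ g(x)ᵀ ∇h(x) < 0`. -/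
def IsCBFStabilizable (E D : Set (EuclideanSpace ℝ (Fin n)))
    (h : EuclideanSpace ℝ (Fin n) → ℝ) (α : ℝ → ℝ)
    (k : EuclideanSpace ℝ (Fin n) → EuclideanSpace ℝ (Fin m))
    (V : EuclideanSpace ℝ (Fin n) → ℝ)
    (G : EuclideanSpace ℝ (Fin n) → Matrix (Fin m) (Fin m) ℝ) (ν : ℝ) : Prop :=
  ∃ A ⊆ sublevel D V ν ∩ constraintSet E h,
    (∀ x ∈ (sublevel D V ν ∩ constraintSet E h) \ A,
      S.lieG V x ⬝ᵥ ((G x)⁻¹ *ᵥ S.lieG h x) < 0) ∧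
    ∀ x ∈ A, 0 ≤ S.barrierMargin h α k x

/-- The regularity condition on `h` relative to a set `M`: either `L_g h` has no zero in `M ∩ E`,
or all its zeros in `M ∩ E` are critical points of `h` in the interior of the constraint set. -/
def IsRegularOn (E : Set (EuclideanSpace ℝ (Fin n))) (h : EuclideanSpace ℝ (Fin n) → ℝ)
    (M : Set (EuclideanSpace ℝ (Fin n))) : Prop :=
  (∀ x ∈ M ∩ E, S.lieG h x ≠ 0) ∨
  (∀ x ∈ M ∩ E, S.lieG h x = 0 → x ∈ constraintInterior E h ∧ gradient h x = 0)

/-- The inputs allowed at `x`: `L_f h(x) + L_g h(x) u ≥ -α(h(x))`. -/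
def feasibleInputs (h : EuclideanSpace ℝ (Fin n) → ℝ) (α : ℝ → ℝ)
    (x : EuclideanSpace ℝ (Fin n)) : Set (EuclideanSpace ℝ (Fin m)) :=
  {u | -α (h x) ≤ S.lieF h x + S.lieG h x ⬝ᵥ u.ofLp}

/-- The cost `½ (u - k)ᵀ G (u - k)`. -/
def _root_.qpCost {m : ℕ} (G : Matrix (Fin m) (Fin m) ℝ) (k u : EuclideanSpace ℝ (Fin m)) : ℝ :=
  1 / 2 * ((u - k).ofLp ⬝ᵥ (G *ᵥ (u - k).ofLp))

/-- `u` solves the quadratic program at `x`. -/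
def IsQPSolution (h : EuclideanSpace ℝ (Fin n) → ℝ) (α : ℝ → ℝ)
    (k : EuclideanSpace ℝ (Fin n) → EuclideanSpace ℝ (Fin m))
    (G : EuclideanSpace ℝ (Fin n) → Matrix (Fin m) (Fin m) ℝ)
    (x : EuclideanSpace ℝ (Fin n)) (u : EuclideanSpace ℝ (Fin m)) : Prop :=
  u ∈ S.feasibleInputs h α x ∧ IsMinOn (qpCost (G x) (k x)) (S.feasibleInputs h α x) u

/-- The controller `u*`: the solution of the quadratic program at each `x`. -/
def qpControl (h : EuclideanSpace ℝ (Fin n) → ℝ) (α : ℝ → ℝ)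
    (k : EuclideanSpace ℝ (Fin n) → EuclideanSpace ℝ (Fin m))
    (G : EuclideanSpace ℝ (Fin n) → Matrix (Fin m) (Fin m) ℝ)
    (x : EuclideanSpace ℝ (Fin n)) : EuclideanSpace ℝ (Fin m) :=
  Classical.epsilon (S.IsQPSolution h α k G x)

end ControlAffineSystem

end

/-! ### Differential equations with a continuous right-hand side -/

/-! The program minimizes a strictly convex quadratic under one affine constraint, so its solution
is k + λ G⁻¹ (L_g h)ᵀ with λ = max(0, -z) / (L_g h G⁻¹ (L_g h)ᵀ), where z is `barrierMargin`
(`isQPSolution_iff`); where L_g h = 0, the barrier condition forces z ≥ 0 and the solution is k.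
Feasibility means ḣ ≥ -α(h) along the closed loop, so h cannot become negative. Moreover V̇ = V̇_k +
λ ∇Vᵀ g G⁻¹ gᵀ ∇h, and on Γ_ν ∩ 𝒞 CBF-stabilizability makes the last term nonpositive, and zero only
if λ = 0. Hence V does not increase, and wherever V̇ = 0 the closed loop coincides with the nominal
one. The two inequalities give invariance of Γ_ν ∩ 𝒞 (`sublevel_inter_constraintSet_invariant`).

As h is merely C¹, the controller is only shown to be continuous, and only on `regularSet`, so
uniqueness of solutions is not available. Existence therefore rests on Peano's theorem, and trapping
is always stated for all solutions from a point; trapping in a compact set yields global existence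
(`forwardComplete_of_trapped`). Convergence is LaSalle's principle
(`tendsto_of_antitone_of_compact`): limits of time translates are solutions with V constant, hence
nominal solutions inside {V̇_k = 0}, hence zero. Stability of the origin needs no compactness of Γ_ν
∩ 𝒞, because a small closed ball takes its place (`exists_trapping_closedBall`). -/

/-- A pointwise limit of equi-Lipschitz curves whose velocities are close to `w` whenever the curves
are close to `y s` has velocity `w` at time `s`. -/
theorem hasDerivWithinAt_of_tendsto_curves {ι X : Type*} [NormedAddCommGroup X] [NormedSpace ℝ X]
    {l : Filter ι} [l.NeBot] {x v : ι → ℝ → X} {y : ℝ → X} {M s : ℝ} {w : X} (hs : 0 ≤ s)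
    (hx : ∀ b, ∀ᶠ i in l, ∀ t ∈ Icc 0 b, HasDerivWithinAt (x i) (v i t) (Icc 0 b) t)
    (hM : ∀ i, ∀ t, 0 ≤ t → ‖v i t‖ ≤ M)
    (hlim : ∀ t, 0 ≤ t → Tendsto (fun i => x i t) l (𝓝 (y t)))
    (hv : ∀ ε > 0, ∃ δ > 0, ∀ᶠ i in l, ∀ t, 0 ≤ t → ‖x i t - y s‖ < δ → ‖v i t - w‖ ≤ ε) :
    HasDerivWithinAt y w (Ici 0) s := by
  rw [hasDerivWithinAt_iff_isLittleO, Asymptotics.isLittleO_iff]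
  intro c hc
  obtain ⟨δ, hδ, hv⟩ := hv c hc
  have hM1 : 0 < |M| + 1 := by positivity
  -- Within time r of s a curve of speed at most M moves by at most δ / 2; the other half of δ pays
  -- for the distance from x i s to y s.
  set r := δ / (2 * (|M| + 1)) with hr
  have hrpos : 0 < r := by positivity
  have hMr : (|M| + 1) * r = δ / 2 := by rw [hr]; field_simp
  have hball : Metric.ball s r ∈ 𝓝[Ici 0] s :=
    mem_nhdsWithin_of_mem_nhds (Metric.ball_mem_nhds s hrpos)
  filter_upwards [hball, self_mem_nhdsWithin] with t ht ht0
  have hlims := hlim s hs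
  have hnear : ∀ᶠ i in l, ‖x i s - y s‖ < δ / 2 := by
    have := hlims.eventually (Metric.ball_mem_nhds (y s) (half_pos hδ))
    filter_upwards [this] with i hi
    rwa [← dist_eq_norm]
  refine le_of_tendsto
    (((hlim t ht0).sub hlims).sub tendsto_const_nhds).norm ?_
  filter_upwards [hx (s + r), hv, hnear] with i hxi hvi hi
  have hsub : ∀ τ ∈ Icc 0 (s + r) ∩ Metric.ball s r, HasDerivWithinAt (x i) (v i τ)
      (Icc 0 (s + r) ∩ Metric.ball s r) τ := fun τ hτ => (hxi τ hτ.1).mono inter_subset_left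
  have hconv : Convex ℝ (Icc 0 (s + r) ∩ Metric.ball s r) :=
    (convex_Icc _ _).inter (convex_ball _ _)
  have hsm : s ∈ Icc 0 (s + r) ∩ Metric.ball s r :=
    ⟨⟨hs, by linarith⟩, Metric.mem_ball_self hrpos⟩
  have htr : |t - s| < r := by rwa [Metric.mem_ball, Real.dist_eq] at ht
  have htm : t ∈ Icc 0 (s + r) ∩ Metric.ball s r :=
    ⟨⟨ht0, by linarith [(abs_lt.1 htr).2]⟩, ht⟩
  have hclose : ∀ τ ∈ Icc 0 (s + r) ∩ Metric.ball s r, ‖v i τ - w‖ ≤ c := by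
    intro τ hτ
    refine hvi τ hτ.1.1 ?_
    have h1 := hconv.norm_image_sub_le_of_norm_hasDerivWithin_le hsub
      (fun u hu => hM i u hu.1.1) hsm hτ
    have h2 : ‖τ - s‖ < r := by simpa [Real.dist_eq] using hτ.2
    have h3 : M * ‖τ - s‖ ≤ δ / 2 := by
      rw [← hMr]
      have := le_abs_self M
      have := norm_nonneg (τ - s)
      nlinarith [abs_nonneg M]
    calc ‖x i τ - y s‖ = ‖(x i τ - x i s) + (x i s - y s)‖ := by congr 1; abel
      _ ≤ ‖x i τ - x i s‖ + ‖x i s - y s‖ := norm_add_le _ _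
      _ < δ := by linarith
  -- The mean value inequality for x i minus the linear motion with velocity w: its bound c * |t -
  -- s| does not depend on i and so survives the limit.
  have := hconv.norm_image_sub_le_of_norm_hasFDerivWithin_le'
    (φ := ContinuousLinearMap.toSpanSingleton ℝ w)
    (fun τ hτ => (hsub τ hτ).hasFDerivWithinAt) (C := c) (fun τ hτ => ?_) hsm htm
  · simpa using this
  · have h4 : ContinuousLinearMap.toSpanSingleton ℝ (v i τ) - ContinuousLinearMap.toSpanSingleton ℝ w
        = ContinuousLinearMap.toSpanSingleton ℝ (v i τ - w) := by
      ext; simp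
    rw [h4, ContinuousLinearMap.norm_toSpanSingleton]
    exact hclose τ hτ

/-- The Peano existence theorem for bounded continuous vector fields. -/
theorem exists_solution_of_continuous_of_bounded {X : Type*} [NormedAddCommGroup X]
    [NormedSpace ℝ X] [FiniteDimensional ℝ X] {F : X → X} (hF : Continuous F) {M : ℝ}
    (hM : ∀ x, ‖F x‖ ≤ M) (x₀ : X) :
    ∃ x : ℝ → X, x 0 = x₀ ∧ ∀ t ∈ Ici (0 : ℝ), HasDerivWithinAt x (F (x t)) (Ici 0) t := by
  have hM0 : 0 ≤ M := (norm_nonneg _).trans (hM x₀)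
  have happrox : ∀ k : ℕ, ∃ g : X → X, ContDiff ℝ 1 g ∧ ∀ x, dist (g x) (F x) < 1 / ((k : ℝ) + 1) := by
    intro k
    obtain ⟨g, hg, hgF, -⟩ := hF.exists_contDiff_approx (ε := fun _ => 1 / ((k : ℝ) + 1)) 1
      continuous_const (fun _ => Nat.one_div_pos_of_nat)
    exact ⟨g, hg, hgF⟩
  choose g hg hgF using happrox
  have hgM : ∀ k x, ‖g k x‖ ≤ M + 1 := by
    intro k x
    have h1 := (hgF k x).le
    rw [dist_eq_norm] at h1
    have h2 : 1 / ((k : ℝ) + 1) ≤ 1 := by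
      rw [div_le_one (by positivity)]
      linarith [k.cast_nonneg (α := ℝ)]
    have h3 := norm_sub_norm_le (g k x) (F x)
    linarith [hM x]
  have hsol : ∀ k : ℕ, ∃ x : ℝ → X, x 0 = x₀ ∧
      ∀ t ∈ Icc (0 : ℝ) k, HasDerivWithinAt x (g k (x t)) (Icc 0 k) t := by
    intro k
    have hk : (0 : ℝ) ∈ Icc (0 : ℝ) k := ⟨le_rfl, k.cast_nonneg⟩
    obtain ⟨K, hK⟩ := (hg k).contDiffOn.exists_lipschitzOnWith one_ne_zero
      (convex_closedBall x₀ ((M + 1) * k)) (isCompact_closedBall x₀ ((M + 1) * k))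
    -- At speed at most M + 1 the radius (M + 1) * k cannot be exceeded by time k. The Lipschitz
    -- constant may depend on k, since only the speed bound enters the limit.
    have hPL : IsPicardLindelof (fun _ => g k) (⟨0, hk⟩ : Icc (0 : ℝ) k) x₀
        (⟨(M + 1) * k, by positivity⟩ : NNReal) 0 (⟨M + 1, by positivity⟩ : NNReal) K :=
      { lipschitzOnWith := fun _ _ => hK
        continuousOn := fun _ _ => continuousOn_const
        norm_le := fun _ _ x _ => hgM k x
        mul_max_le := by
          change (M + 1) * max ((k : ℝ) - 0) (0 - 0) ≤ (M + 1) * k - 0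
          simp }
    exact hPL.exists_eq_forall_mem_Icc_hasDerivWithinAt₀
  choose x hx0 hx using hsol
  -- An ultrafilter replaces the diagonal subsequence of Arzelà–Ascoli: along it the bounded values
  -- x k t converge for every t at once.
  let U : Ultrafilter ℕ := hyperfilter ℕ
  have hU : (U : Filter ℕ) ≤ atTop := Nat.hyperfilter_le_atTop
  have hbig : ∀ b : ℝ, ∀ᶠ k : ℕ in (U : Filter ℕ), b ≤ k :=
    fun b => hU (tendsto_natCast_atTop_atTop.eventually_ge_atTop b)
  have hlim : ∀ t : ℝ, ∃ y : X, 0 ≤ t → Tendsto (fun k => x k t) U (𝓝 y) := by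
    intro t
    by_cases ht : 0 ≤ t
    · have hmem : Metric.closedBall x₀ ((M + 1) * t) ∈ U.map (fun k => x k t) := by
        rw [Ultrafilter.mem_map]
        filter_upwards [hbig t] with k hk
        have := (convex_Icc (0 : ℝ) k).norm_image_sub_le_of_norm_hasDerivWithin_le (hx k)
          (fun u _ => hgM k _) (left_mem_Icc.2 (ht.trans hk)) ⟨ht, hk⟩
        rw [hx0, sub_zero, Real.norm_of_nonneg ht] at this
        rwa [mem_preimage, Metric.mem_closedBall, dist_eq_norm]
      obtain ⟨y, -, hy⟩ := (isCompact_closedBall x₀ ((M + 1) * t)).ultrafilter_le_nhds' _ hmem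
      exact ⟨y, fun _ => hy⟩
    · exact ⟨0, fun h => absurd h ht⟩
  choose y hy using hlim
  refine ⟨y, tendsto_nhds_unique (hy 0 le_rfl) ?_, fun s hs => ?_⟩
  · simp only [hx0]
    exact tendsto_const_nhds
  · refine hasDerivWithinAt_of_tendsto_curves (l := (U : Filter ℕ)) (v := fun k t => g k (x k t))
      (M := M + 1) hs (fun b => ?_) (fun k t _ => hgM k _) hy (fun ε hε => ?_)
    · filter_upwards [hbig b] with k hk t ht
      exact (hx k t ⟨ht.1, ht.2.trans hk⟩).mono (Icc_subset_Icc_right hk)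
    · obtain ⟨δ, hδ, hδF⟩ := Metric.continuous_iff.1 hF (y s) (ε / 2) (half_pos hε)
      refine ⟨δ, hδ, ?_⟩
      have hsmall : ∀ᶠ k : ℕ in (U : Filter ℕ), 1 / ((k : ℝ) + 1) < ε / 2 :=
        hU (tendsto_one_div_add_atTop_nhds_zero_nat.eventually (gt_mem_nhds (half_pos hε)))
      filter_upwards [hsmall] with k hk t _ hxt
      rw [← dist_eq_norm] at hxt ⊢
      linarith [dist_triangle (g k (x k t)) (F (x k t)) (F (y s)), hgF k (x k t), hδF _ hxt]

/-- The translates of a solution that stays in a compact set converge pointwise, along any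
ultrafilter of times tending to infinity, to a solution in the same compact set. -/
theorem exists_limit_solution {X : Type*} [NormedAddCommGroup X] [NormedSpace ℝ X] {F : X → X}
    {K : Set X} (hK : IsCompact K) (hF : ContinuousOn F K) {x : ℝ → X}
    (hx : ∀ t ∈ Ici (0 : ℝ), x t ∈ K ∧ HasDerivWithinAt x (F (x t)) (Ici 0) t)
    (U : Ultrafilter ℝ) (hU : (U : Filter ℝ) ≤ atTop) :
    ∃ y : ℝ → X, (∀ t, 0 ≤ t → Tendsto (fun s => x (s + t)) U (𝓝 (y t))) ∧
      ∀ t ∈ Ici (0 : ℝ), y t ∈ K ∧ HasDerivWithinAt y (F (y t)) (Ici 0) t := by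
  obtain ⟨M, hM⟩ := hK.exists_bound_of_continuousOn hF
  have hpos : ∀ᶠ s in (U : Filter ℝ), 0 ≤ s := hU (eventually_ge_atTop 0)
  have hlim : ∀ t : ℝ, ∃ y : X, 0 ≤ t → y ∈ K ∧ Tendsto (fun s => x (s + t)) U (𝓝 y) := by
    intro t
    by_cases ht : 0 ≤ t
    · have hmem : K ∈ U.map (fun s => x (s + t)) := by
        rw [Ultrafilter.mem_map]
        filter_upwards [hpos] with s hs
        exact (hx (s + t) (add_nonneg hs ht)).1
      obtain ⟨y, hyK, hy⟩ := hK.ultrafilter_le_nhds' _ hmem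
      exact ⟨y, fun _ => ⟨hyK, hy⟩⟩
    · exact ⟨0, fun h => absurd h ht⟩
  choose y hy using hlim
  refine ⟨y, fun t ht => (hy t ht).2, fun s hs => ⟨(hy s hs).1, ?_⟩⟩
  -- Truncating the shift to max a 0 keeps every translate inside the domain of the solution, so the
  -- speed bound holds for all a; along U nothing changes.
  refine hasDerivWithinAt_of_tendsto_curves (l := (U : Filter ℝ))
    (x := fun a t => x (max a 0 + t)) (v := fun a t => F (x (max a 0 + t))) (M := M) hs
    (fun b => ?_) (fun a t ht => hM _ (hx _ (add_nonneg (le_max_right _ _) ht)).1)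
    (fun t ht => ?_) (fun ε hε => ?_)
  · refine Eventually.of_forall fun a t ht => ?_
    have h1 := (hx (max a 0 + t) (add_nonneg (le_max_right _ _) ht.1)).2
    have h2 : HasDerivWithinAt (fun τ : ℝ => max a 0 + τ) 1 (Icc 0 b) t :=
      ((hasDerivAt_id t).const_add _).hasDerivWithinAt
    have h3 := h1.scomp t h2 (fun τ hτ => add_nonneg (le_max_right _ _) hτ.1)
    rw [one_smul] at h3
    exact h3
  · refine (hy t ht).2.congr' ?_
    filter_upwards [hpos] with a ha
    rw [max_eq_left ha]
  · obtain ⟨δ, hδ, hδF⟩ := Metric.continuousOn_iff.1 hF (y s) (hy s hs).1 ε hε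
    refine ⟨δ, hδ, Eventually.of_forall fun a t ht hat => ?_⟩
    rw [← dist_eq_norm] at hat ⊢
    exact (hδF _ (hx _ (add_nonneg (le_max_right _ _) ht)).1 hat).le

/-- LaSalle's invariance principle for solutions of an equation with continuous right-hand side that
stay in a compact set, when only solutions starting at `p` keep the function `V` constant. -/
theorem tendsto_of_antitone_of_compact {X : Type*} [NormedAddCommGroup X] [NormedSpace ℝ X]
    {F : X → X} {K : Set X} (hK : IsCompact K) (hF : ContinuousOn F K) {V : X → ℝ}
    (hV : ContinuousOn V K) {p : X} {x : ℝ → X}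
    (hx : ∀ t ∈ Ici (0 : ℝ), x t ∈ K ∧ HasDerivWithinAt x (F (x t)) (Ici 0) t)
    (hanti : AntitoneOn (fun t => V (x t)) (Ici 0))
    (hp : ∀ y : ℝ → X, (∀ t ∈ Ici (0 : ℝ), y t ∈ K ∧ HasDerivWithinAt y (F (y t)) (Ici 0) t) →
      (∀ t ∈ Ici (0 : ℝ), V (y t) = V (y 0)) → y 0 = p) :
    Tendsto x atTop (𝓝 p) := by
  rw [tendsto_iff_ultrafilter]
  intro U hU
  obtain ⟨y, hylim, hy⟩ := exists_limit_solution hK hF hx U hU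
  have hpos : ∀ᶠ s in (U : Filter ℝ), 0 ≤ s := hU (eventually_ge_atTop 0)
  have hVlim : ∀ t, 0 ≤ t → Tendsto (fun s => V (x (s + t))) U (𝓝 (V (y t))) := by
    intro t ht
    refine (hV (y t) (hy t ht).1).tendsto.comp (tendsto_nhdsWithin_iff.2 ⟨hylim t ht, ?_⟩)
    filter_upwards [hpos] with s hs
    exact (hx _ (add_nonneg hs ht)).1
  obtain ⟨c, hc⟩ : ∃ c, Tendsto (fun s => V (x s)) atTop (𝓝 c) := by
    have hanti' : Antitone fun s : ℝ => V (x (max s 0)) := fun a b hab =>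
      hanti (mem_Ici.2 (le_max_right a 0)) (mem_Ici.2 (le_max_right b 0)) (max_le_max_right 0 hab)
    obtain ⟨m, hm⟩ := (hK.image_of_continuousOn hV).bddBelow
    have hbdd : BddBelow (range fun s : ℝ => V (x (max s 0))) := by
      refine ⟨m, ?_⟩
      rintro _ ⟨s, rfl⟩
      exact hm ⟨_, (hx _ (mem_Ici.2 (le_max_right s 0))).1, rfl⟩
    refine ⟨_, (tendsto_atTop_ciInf hanti' hbdd).congr' ?_⟩
    filter_upwards [eventually_ge_atTop 0] with s hs
    rw [max_eq_left hs]
  -- A monotone function and its time translates have the same limit at infinity.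
  have hconst : ∀ t, 0 ≤ t → V (y t) = c := by
    intro t ht
    refine tendsto_nhds_unique (hVlim t ht) ?_
    exact (hc.comp (tendsto_atTop_add_const_right _ t tendsto_id)).mono_left hU
  have h0 := hp y hy fun t ht => by rw [hconst t ht, hconst 0 le_rfl]
  have := hylim 0 le_rfl
  simpa [h0] using this

/-! ### Continuation of solutions trapped in a compact set -/

/-- A vector field that is continuous on a compact set agrees there with a bounded continuous vector
field on the whole space. -/
theorem exists_bounded_extension {n : ℕ}
    {F : EuclideanSpace ℝ (Fin n) → EuclideanSpace ℝ (Fin n)}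
    {K : Set (EuclideanSpace ℝ (Fin n))} (hK : IsCompact K) (hF : ContinuousOn F K) :
    ∃ H : EuclideanSpace ℝ (Fin n) → EuclideanSpace ℝ (Fin n), Continuous H ∧
      (∃ M, ∀ x, ‖H x‖ ≤ M) ∧ EqOn H F K := by
  have : CompactSpace K := isCompact_iff_compactSpace.1 hK
  obtain ⟨H, -, hHF⟩ := (BoundedContinuousFunction.mkOfCompact
    ⟨K.domRestrict F, hF.domRestrict⟩).exists_norm_eq_domRestrict_eq (𝕜 := ℝ) hK.isClosed
  refine ⟨H, H.continuous, ⟨‖H‖, H.norm_coe_le_norm⟩, fun x hx => ?_⟩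
  exact congrArg (fun φ => φ ⟨x, hx⟩) hHF

theorem mem_of_isClosed_of_forall_Ico {X : Type*} [TopologicalSpace X] {K : Set X}
    (hK : IsClosed K) {x : ℝ → X} {T : ℝ} (hT : 0 < T) (hx : ContinuousWithinAt x (Iio T) T)
    (h : ∀ t ∈ Ico 0 T, x t ∈ K) : x T ∈ K :=
  hK.mem_of_tendsto hx.tendsto (by
    filter_upwards [Ioo_mem_nhdsLT hT] with t ht using h t ⟨ht.1.le, ht.2⟩)

/-- If all solutions from `x₀` are trapped in the compact set `K`, then so are all solutions of an
equation whose right-hand side is the same near `K`. -/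
theorem mem_of_trapped {n : ℕ} {F H : EuclideanSpace ℝ (Fin n) → EuclideanSpace ℝ (Fin n)}
    {Ω W K : Set (EuclideanSpace ℝ (Fin n))} (hW : IsOpen W) (hWΩ : W ⊆ Ω) (hKW : K ⊆ W)
    (hK : IsClosed K) (hHF : EqOn H F W) {x₀ : EuclideanSpace ℝ (Fin n)} (hx₀ : x₀ ∈ K)
    (htrap : ∀ T : ℝ, 0 < T → ∀ x : ℝ → EuclideanSpace ℝ (Fin n),
      IsSolutionOn F Ω (Ico 0 T) x → x 0 = x₀ → ∀ t ∈ Ico 0 T, x t ∈ K)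
    {z : ℝ → EuclideanSpace ℝ (Fin n)} (hz0 : z 0 = x₀)
    (hz : ∀ t ∈ Ici (0 : ℝ), HasDerivWithinAt z (H (z t)) (Ici 0) t) :
    ∀ t, 0 ≤ t → z t ∈ K := by
  have hzc : ContinuousOn z (Ici 0) := HasDerivWithinAt.continuousOn hz
  have key : ∀ T, 0 < T → (∀ t ∈ Ico 0 T, z t ∈ W) → z T ∈ K := by
    intro T hT hzW
    have hcont : ContinuousWithinAt z (Iio T) T :=
      (hzc.continuousAt (Ici_mem_nhds hT)).continuousWithinAt
    refine mem_of_isClosed_of_forall_Ico hK hT hcont (htrap T hT z (fun t ht => ?_) hz0)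
    refine ⟨hWΩ (hzW t ht), ?_⟩
    rw [← hHF (hzW t ht)]
    exact (hz t ht.1).mono Ico_subset_Ici_self
  intro b hb
  rcases hb.eq_or_lt with rfl | hb
  · rwa [hz0]
  by_contra hbK
  have hne : ∃ t ∈ Ico 0 b, z t ∉ W := by
    by_contra! hcon
    exact hbK (key b hb hcon)
  obtain ⟨t, ht, htW⟩ := hne
  have hcomp : IsCompact (Icc 0 b ∩ z ⁻¹' Wᶜ) :=
    isCompact_Icc.of_isClosed_subset
      ((hzc.mono Icc_subset_Ici_self).preimage_isClosed_of_isClosed isClosed_Icc hW.isClosed_compl)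
      inter_subset_left
  -- At the first exit time from W, `key` puts the curve in K ⊆ W, which is absurd.
  obtain ⟨t₁, ht₁, hleast⟩ := hcomp.exists_isLeast ⟨t, Ico_subset_Icc_self ht, htW⟩
  have ht₁0 : 0 < t₁ := by
    rcases ht₁.1.1.eq_or_lt with h | h
    · exact absurd (hKW hx₀) (by rw [← hz0, h]; exact ht₁.2)
    · exact h
  refine ht₁.2 (hKW (key t₁ ht₁0 fun s hs => ?_))
  by_contra hsW
  exact absurd (hleast ⟨⟨hs.1, hs.2.le.trans ht₁.1.2⟩, hsW⟩) (not_le.2 hs.2)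

/-- A solution on `[0, T)` in a compact set has a limit at `T`. -/
theorem exists_left_limit {X : Type*} [NormedAddCommGroup X] [NormedSpace ℝ X] {F : X → X}
    {K : Set X} (hK : IsCompact K) (hF : ContinuousOn F K) {x : ℝ → X} {T : ℝ} (hT : 0 < T)
    (hxK : ∀ t ∈ Ico 0 T, x t ∈ K)
    (hx : ∀ t ∈ Ico 0 T, HasDerivWithinAt x (F (x t)) (Ico 0 T) t) :
    ∃ p ∈ K, Tendsto x (𝓝[<] T) (𝓝 p) := by
  obtain ⟨M, hM⟩ := hK.exists_bound_of_continuousOn hF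
  have hIco : Ico 0 T ∈ 𝓝[<] T := Ico_mem_nhdsLT hT
  let U : Ultrafilter ℝ := Ultrafilter.of (𝓝[<] T)
  have hU : (U : Filter ℝ) ≤ 𝓝[<] T := Ultrafilter.of_le _
  have hmem : K ∈ U.map x := by
    rw [Ultrafilter.mem_map]
    filter_upwards [hU hIco] with t ht using hxK t ht
  obtain ⟨p, hpK, hp⟩ := hK.ultrafilter_le_nhds' _ hmem
  refine ⟨p, hpK, ?_⟩
  have hid : Tendsto (fun s : ℝ => s) (𝓝[<] T) (𝓝 T) := tendsto_id.mono_left nhdsWithin_le_nhds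
  -- Letting s tend to T along U in the Lipschitz estimate turns the cluster point p into a genuine
  -- limit.
  have hbound : ∀ t ∈ Ico 0 T, ‖x t - p‖ ≤ M * ‖t - T‖ := by
    intro t ht
    have h1 : Tendsto (fun s => ‖x t - x s‖) U (𝓝 ‖x t - p‖) := (tendsto_const_nhds.sub hp).norm
    have h2 : Tendsto (fun s => M * ‖t - s‖) U (𝓝 (M * ‖t - T‖)) :=
      ((tendsto_const_nhds.sub (hid.mono_left hU)).norm).const_mul M
    refine le_of_tendsto_of_tendsto h1 h2 ?_
    filter_upwards [hU hIco] with s hs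
    exact (convex_Ico 0 T).norm_image_sub_le_of_norm_hasDerivWithin_le hx
      (fun u hu => hM _ (hxK u hu)) hs ht
  rw [tendsto_iff_norm_sub_tendsto_zero]
  have h0 : Tendsto (fun t => M * ‖t - T‖) (𝓝[<] T) (𝓝 0) := by
    have := ((hid.sub (tendsto_const_nhds (x := T))).norm).const_mul M
    simpa using this
  refine squeeze_zero' (Eventually.of_forall fun _ => norm_nonneg _) ?_ h0
  filter_upwards [hIco] with t ht using hbound t ht

/-- Gluing a solution on `[0, T)` with one that starts from its limit at `T`. -/
theorem hasDerivWithinAt_glue {X : Type*} [NormedAddCommGroup X] [NormedSpace ℝ X] {H : X → X}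
    (hH : Continuous H) {x w : ℝ → X} {T : ℝ} (hT : 0 < T)
    (hx : ∀ t ∈ Ico 0 T, HasDerivWithinAt x (H (x t)) (Ico 0 T) t)
    (hw : ∀ t ∈ Ici (0 : ℝ), HasDerivWithinAt w (H (w t)) (Ici 0) t)
    (hlim : Tendsto x (𝓝[<] T) (𝓝 (w 0))) :
    ∀ t ∈ Ici (0 : ℝ), HasDerivWithinAt (fun t => if t < T then x t else w (t - T))
      (H (if t < T then x t else w (t - T))) (Ici 0) t := by
  set z : ℝ → X := fun t => if t < T then x t else w (t - T) with hzdef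
  have hzx : ∀ t < T, z t = x t := fun t ht => if_pos ht
  have hzw : ∀ t, T ≤ t → z t = w (t - T) := fun t ht => if_neg (not_lt.2 ht)
  have hleft : ∀ t ∈ Ico 0 T, HasDerivWithinAt z (H (z t)) (Ici 0) t := by
    intro t ht
    rw [hzx t ht.2]
    have h1 : HasDerivWithinAt x (H (x t)) (Ici 0) t := by
      refine (hx t ht).mono_of_mem_nhdsWithin ?_
      rw [← Ici_inter_Iio]
      exact inter_mem self_mem_nhdsWithin (mem_nhdsWithin_of_mem_nhds (Iio_mem_nhds ht.2))
    refine h1.congr_of_eventuallyEq ?_ (hzx t ht.2)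
    filter_upwards [mem_nhdsWithin_of_mem_nhds (Iio_mem_nhds ht.2)] with s hs using hzx s hs
  have hright : ∀ t, T ≤ t → HasDerivWithinAt z (H (z t)) (Ici T) t := by
    intro t ht
    have h1 : HasDerivWithinAt (fun τ : ℝ => τ - T) 1 (Ici T) t :=
      ((hasDerivAt_id t).sub_const T).hasDerivWithinAt
    have h2 := (hw (t - T) (sub_nonneg.2 ht)).scomp t h1 (fun τ hτ => sub_nonneg.2 hτ)
    rw [one_smul, ← hzw t ht] at h2
    exact h2.congr (fun τ hτ => hzw τ hτ) (hzw t ht)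
  intro t ht
  change HasDerivWithinAt z (H (z t)) (Ici 0) t
  rcases lt_trichotomy t T with h | rfl | h
  · exact hleft t ⟨ht, h⟩
  · have hzt : z t = w 0 := by rw [hzw t le_rfl, sub_self]
    have hIoo : Ioo 0 t ∈ 𝓝[<] t := Ioo_mem_nhdsLT hT
    have hderiv : ∀ s ∈ Ioo 0 t, HasDerivAt z (H (x s)) s := fun s hs => by
      have := (hleft s ⟨hs.1.le, hs.2⟩).hasDerivAt (Ici_mem_nhds hs.1)
      rwa [hzx s hs.2] at this
    have hzlim : Tendsto z (𝓝[<] t) (𝓝 (z t)) := by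
      rw [hzt]
      refine hlim.congr' ?_
      filter_upwards [self_mem_nhdsWithin] with s hs using (hzx s hs).symm
    -- The left derivative at the junction is the limit of the derivatives H (x s), by continuity of
    -- H.
    have h1 : HasDerivWithinAt z (H (z t)) (Iic t) t := by
      refine hasDerivWithinAt_Iic_of_tendsto_deriv
        (fun s hs => (hderiv s hs).differentiableAt.differentiableWithinAt)
        (hzlim.mono_left (nhdsWithin_mono _ Ioo_subset_Iio_self)) hIoo ?_
      rw [hzt]
      refine ((hH.tendsto _).comp hlim).congr' ?_
      filter_upwards [hIoo] with s hs using (hderiv s hs).deriv.symm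
    have h2 := h1.union (hright t le_rfl)
    rw [Iic_union_Ici] at h2
    exact h2.mono (subset_univ _)
  · exact ((hright t h.le).hasDerivAt (Ici_mem_nhds h)).hasDerivWithinAt

/-- If all solutions from `x₀` are trapped in a compact set near which the right-hand side is
continuous, then all maximal solutions from `x₀` exist for all `t ≥ 0`. -/
theorem forwardComplete_of_trapped {n : ℕ}
    {F : EuclideanSpace ℝ (Fin n) → EuclideanSpace ℝ (Fin n)}
    {Ω U K : Set (EuclideanSpace ℝ (Fin n))} (hU : IsOpen U) (hUΩ : U ⊆ Ω) (hKU : K ⊆ U)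
    (hK : IsCompact K) (hF : ContinuousOn F U) {x₀ : EuclideanSpace ℝ (Fin n)} (hx₀ : x₀ ∈ K)
    (htrap : ∀ T : ℝ, 0 < T → ∀ x : ℝ → EuclideanSpace ℝ (Fin n),
      IsSolutionOn F Ω (Ico 0 T) x → x 0 = x₀ → ∀ t ∈ Ico 0 T, x t ∈ K) :
    ForwardComplete F Ω x₀ := by
  obtain ⟨K', hK', hKK', hK'U⟩ := exists_compact_between hK hU hKU
  obtain ⟨H, hH, ⟨M, hM⟩, hHF⟩ := exists_bounded_extension hK' (hF.mono hK'U)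
  have hHFK : EqOn H F K := hHF.mono (hKK'.trans interior_subset)
  have hKΩ : K ⊆ Ω := hKU.trans hUΩ
  have global : ∀ z : ℝ → EuclideanSpace ℝ (Fin n), z 0 = x₀ →
      (∀ t ∈ Ici (0 : ℝ), HasDerivWithinAt z (H (z t)) (Ici 0) t) → IsSolutionOn F Ω (Ici 0) z := by
    intro z hz0 hz t ht
    have hzK := mem_of_trapped isOpen_interior (interior_subset.trans (hK'U.trans hUΩ)) hKK'
      hK.isClosed (hHF.mono interior_subset) hx₀ htrap hz0 hz t ht
    refine ⟨hKΩ hzK, ?_⟩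
    rw [← hHFK hzK]
    exact hz t ht
  constructor
  · obtain ⟨z, hz0, hz⟩ := exists_solution_of_continuous_of_bounded hH hM x₀
    exact ⟨z, global z hz0 hz, hz0⟩
  · intro T hT x hx hx0
    have hxK := htrap T hT x hx hx0
    obtain ⟨p, -, hlim⟩ := exists_left_limit hK (hF.mono hKU) hT hxK fun t ht => (hx t ht).2
    -- The restart solves the equation of H, without any trapping assumption at p. The glued curve
    -- starts at x₀, so `global` makes it a solution for F.
    obtain ⟨w, rfl, hw⟩ := exists_solution_of_continuous_of_bounded hH hM p
    refine ⟨fun t => if t < T then x t else w (t - T), global _ (by simp [hT, hx0])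
      (hasDerivWithinAt_glue hH hT (fun t ht => ?_) hw hlim), fun t ht => (if_pos ht.2).symm⟩
    rw [hHFK (hxK t ht)]
    exact (hx t ht).2

/-! ### The quadratic program -/

section QuadraticProgram

variable {m : ℕ} {G : Matrix (Fin m) (Fin m) ℝ}

theorem Matrix.PosDef.mulVec_inv_mulVec (hG : G.PosDef) (b : Fin m → ℝ) : G *ᵥ (G⁻¹ *ᵥ b) = b := by
  rw [Matrix.mulVec_mulVec, Matrix.mul_nonsing_inv _ ((Matrix.isUnit_iff_isUnit_det _).1 hG.isUnit),
    Matrix.one_mulVec]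

theorem Matrix.PosDef.dotProduct_mulVec_comm (hG : G.PosDef) (v w : Fin m → ℝ) :
    v ⬝ᵥ (G *ᵥ w) = w ⬝ᵥ (G *ᵥ v) := by
  have hT : Gᵀ = G := by simpa using hG.isHermitian.eq
  rw [Matrix.dotProduct_mulVec, ← Matrix.mulVec_transpose, hT, dotProduct_comm]

theorem Matrix.PosDef.dotProduct_inv_mulVec_pos (hG : G.PosDef) {b : Fin m → ℝ} (hb : b ≠ 0) :
    0 < b ⬝ᵥ (G⁻¹ *ᵥ b) := by
  simpa using hG.inv.dotProduct_mulVec_pos hb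

/-- The Lagrange multiplier of the problem `min ½ wᵀ G w` subject to `z + bᵀ w ≥ 0`. -/
noncomputable def qpMultiplier (G : Matrix (Fin m) (Fin m) ℝ) (b : Fin m → ℝ) (z : ℝ) : ℝ :=
  max 0 (-z) / (b ⬝ᵥ (G⁻¹ *ᵥ b))

theorem qpMultiplier_of_nonneg {b : Fin m → ℝ} {z : ℝ} (hz : 0 ≤ z) : qpMultiplier G b z = 0 := by
  rw [qpMultiplier, max_eq_left (by linarith), zero_div]

theorem qpMultiplier_nonneg (hG : G.PosDef) (b : Fin m → ℝ) (z : ℝ) : 0 ≤ qpMultiplier G b z := by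
  refine div_nonneg (le_max_left _ _) ?_
  simpa using hG.inv.posSemidef.dotProduct_mulVec_nonneg b

/-- If b = 0, division by zero gives multiplier 0, and both sides vanish because z ≥ 0. -/
theorem qpMultiplier_mul (hG : G.PosDef) {b : Fin m → ℝ} {z : ℝ} (hz : b = 0 → 0 ≤ z) :
    b ⬝ᵥ (qpMultiplier G b z • (G⁻¹ *ᵥ b)) = max 0 (-z) := by
  rw [dotProduct_smul, smul_eq_mul]
  by_cases hb : b = 0
  · simp [hb, hz hb]
  · exact div_mul_cancel₀ _ (hG.dotProduct_inv_mulVec_pos hb).ne'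

/-- The vector `λ G⁻¹ b` minimizes `wᵀ G w` among the vectors with `z + bᵀ w ≥ 0`. -/
theorem add_quadratic_le_of_feasible (hG : G.PosDef) {b : Fin m → ℝ} {z : ℝ} (hz : b = 0 → 0 ≤ z)
    {w : Fin m → ℝ} (hw : 0 ≤ z + b ⬝ᵥ w) :
    (qpMultiplier G b z • (G⁻¹ *ᵥ b)) ⬝ᵥ (G *ᵥ (qpMultiplier G b z • (G⁻¹ *ᵥ b))) +
      (w - qpMultiplier G b z • (G⁻¹ *ᵥ b)) ⬝ᵥ (G *ᵥ (w - qpMultiplier G b z • (G⁻¹ *ᵥ b)))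
      ≤ w ⬝ᵥ (G *ᵥ w) := by
  have hmul := qpMultiplier_mul hG hz
  have hl := qpMultiplier_nonneg hG b z
  have hGv : G *ᵥ (qpMultiplier G b z • (G⁻¹ *ᵥ b)) = qpMultiplier G b z • b := by
    rw [Matrix.mulVec_smul, hG.mulVec_inv_mulVec]
  -- Complementary slackness: the multiplier vanishes unless z < 0, and then feasibility reads bᵀ w
  -- ≥ -z. This is the sign of the cross term in the expansion of wᵀ G w around the minimizer.
  have hcross : 0 ≤ qpMultiplier G b z * (b ⬝ᵥ w - max 0 (-z)) := by
    rcases le_total 0 z with h | h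
    · rw [qpMultiplier_of_nonneg h, zero_mul]
    · rw [max_eq_right (by linarith)]
      exact mul_nonneg hl (by linarith)
  set v := qpMultiplier G b z • (G⁻¹ *ᵥ b) with hv
  have hcomm := hG.dotProduct_mulVec_comm v w
  have h1 : v ⬝ᵥ (G *ᵥ v) = qpMultiplier G b z * max 0 (-z) := by
    rw [hGv, dotProduct_smul, dotProduct_comm, hmul, smul_eq_mul]
  have h2 : w ⬝ᵥ (G *ᵥ v) = qpMultiplier G b z * (b ⬝ᵥ w) := by
    rw [hGv, dotProduct_smul, dotProduct_comm, smul_eq_mul]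
  simp only [Matrix.mulVec_sub, sub_dotProduct, dotProduct_sub]
  linarith

end QuadraticProgram

/-! ### The closed form of the controller and the derivative of V -/

namespace ControlAffineSystem

variable {n m : ℕ} (S : ControlAffineSystem n m) {E D : Set (EuclideanSpace ℝ (Fin n))}
  {h V : EuclideanSpace ℝ (Fin n) → ℝ} {α : ℝ → ℝ}
  {k : EuclideanSpace ℝ (Fin n) → EuclideanSpace ℝ (Fin m)}
  {G : EuclideanSpace ℝ (Fin n) → Matrix (Fin m) (Fin m) ℝ}
  {x : EuclideanSpace ℝ (Fin n)} {ν : ℝ}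

theorem inner_gradient_rhs (φ : EuclideanSpace ℝ (Fin n) → ℝ) (x : EuclideanSpace ℝ (Fin n))
    (u : EuclideanSpace ℝ (Fin m)) :
    inner ℝ (gradient φ x) (S.rhs x u) = S.lieF φ x + S.lieG φ x ⬝ᵥ u.ofLp := by
  rw [rhs, inner_add_right, lieF, lieG, ← Matrix.dotProduct_mulVec]
  congr 1
  rw [EuclideanSpace.inner_eq_star_dotProduct, star_trivial, dotProduct_comm]

/-- The expression under the supremum no longer depends on the input, so the supremum is its
constant value. -/
theorem barrierMargin_nonneg_of_lieG_eq_zero (hZ : S.IsZCBF E h α) (hx : x ∈ E)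
    (hb : S.lieG h x = 0) : 0 ≤ S.barrierMargin h α k x := by
  have := hZ.barrier x hx
  simp only [hb, zero_dotProduct, add_zero, iSup_const] at this
  rw [barrierMargin, hb, zero_dotProduct, add_zero]
  exact_mod_cast this

theorem mem_feasibleInputs_iff (u : EuclideanSpace ℝ (Fin m)) :
    u ∈ S.feasibleInputs h α x ↔
      0 ≤ S.barrierMargin h α k x + S.lieG h x ⬝ᵥ (u - k x).ofLp := by
  rw [feasibleInputs, mem_ofPred_eq, barrierMargin, WithLp.ofLp_sub, dotProduct_sub]
  constructor <;> intro _ <;> linarith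

/-- The closed form of the solution of the quadratic program. -/
noncomputable def qpFormula (h : EuclideanSpace ℝ (Fin n) → ℝ) (α : ℝ → ℝ)
    (k : EuclideanSpace ℝ (Fin n) → EuclideanSpace ℝ (Fin m))
    (G : EuclideanSpace ℝ (Fin n) → Matrix (Fin m) (Fin m) ℝ)
    (x : EuclideanSpace ℝ (Fin n)) : EuclideanSpace ℝ (Fin m) :=
  k x + WithLp.toLp 2 (qpMultiplier (G x) (S.lieG h x) (S.barrierMargin h α k x) •
    ((G x)⁻¹ *ᵥ S.lieG h x))

/-- The quadratic remainder in `add_quadratic_le_of_feasible` gives optimality, and, by definiteness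
of G, uniqueness. -/
theorem isQPSolution_iff (hZ : S.IsZCBF E h α) (hx : x ∈ E) (hG : (G x).PosDef)
    (u : EuclideanSpace ℝ (Fin m)) :
    S.IsQPSolution h α k G x u ↔ u = S.qpFormula h α k G x := by
  have hz : S.lieG h x = 0 → 0 ≤ S.barrierMargin h α k x :=
    S.barrierMargin_nonneg_of_lieG_eq_zero hZ hx
  have hsub : (S.qpFormula h α k G x - k x).ofLp =
      qpMultiplier (G x) (S.lieG h x) (S.barrierMargin h α k x) • ((G x)⁻¹ *ᵥ S.lieG h x) := by
    rw [qpFormula, add_sub_cancel_left]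
  have hfeas : S.qpFormula h α k G x ∈ S.feasibleInputs h α x := by
    rw [S.mem_feasibleInputs_iff (k := k), hsub, qpMultiplier_mul hG hz]
    linarith [le_max_right 0 (-S.barrierMargin h α k x)]
  have hopt : ∀ v ∈ S.feasibleInputs h α x, qpCost (G x) (k x) (S.qpFormula h α k G x) +
      1 / 2 * ((v - S.qpFormula h α k G x).ofLp ⬝ᵥ
        (G x *ᵥ (v - S.qpFormula h α k G x).ofLp)) ≤ qpCost (G x) (k x) v := by
    intro v hv
    have hle := add_quadratic_le_of_feasible hG hz ((S.mem_feasibleInputs_iff v).1 hv)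
    rw [← hsub, ← WithLp.ofLp_sub 2 (v - k x), sub_sub_sub_cancel_right] at hle
    simp only [qpCost]
    linarith
  constructor
  · intro hu
    by_contra hne
    have hne' : (u - S.qpFormula h α k G x).ofLp ≠ 0 := fun h0 =>
      hne (sub_eq_zero.1 ((WithLp.ofLp_eq_zero 2).1 h0))
    have h1 := hG.dotProduct_mulVec_pos hne'
    rw [star_trivial] at h1
    have h2 := hopt u hu.1
    have h3 := isMinOn_iff.1 hu.2 _ hfeas
    linarith
  · rintro rfl
    refine ⟨hfeas, isMinOn_iff.2 fun v hv => ?_⟩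
    have h1 := hG.posSemidef.dotProduct_mulVec_nonneg (v - S.qpFormula h α k G x).ofLp
    rw [star_trivial] at h1
    linarith [hopt v hv]

theorem qpControl_eq (hZ : S.IsZCBF E h α) (hx : x ∈ E) (hG : (G x).PosDef) :
    S.qpControl h α k G x = S.qpFormula h α k G x :=
  (S.isQPSolution_iff hZ hx hG _).1
    (Classical.epsilon_spec ⟨_, (S.isQPSolution_iff hZ hx hG _).2 rfl⟩)

theorem qpFormula_of_margin_nonneg (hz : 0 ≤ S.barrierMargin h α k x) :
    S.qpFormula h α k G x = k x := by
  rw [qpFormula, qpMultiplier_of_nonneg hz, zero_smul, WithLp.toLp_zero, add_zero]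

/-- Along the loop closed with the quadratic program, `h` satisfies the barrier inequality. -/
theorem neg_le_lieClosedLoop_qpControl (hZ : S.IsZCBF E h α) (hx : x ∈ E) (hG : (G x).PosDef) :
    -α (h x) ≤ inner ℝ (gradient h x) (S.closedLoop (S.qpControl h α k G) x) := by
  have hfeas := ((S.isQPSolution_iff (k := k) hZ hx hG _).2 rfl).1
  rw [closedLoop, S.qpControl_eq hZ hx hG, inner_gradient_rhs]
  exact hfeas

theorem lieClosedLoop_qpControl (hZ : S.IsZCBF E h α) (hx : x ∈ E) (hG : (G x).PosDef) :
    S.lieClosedLoop V (S.qpControl h α k G) x = S.lieClosedLoop V k x +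
      qpMultiplier (G x) (S.lieG h x) (S.barrierMargin h α k x) *
        (S.lieG V x ⬝ᵥ ((G x)⁻¹ *ᵥ S.lieG h x)) := by
  simp only [lieClosedLoop, closedLoop, S.qpControl_eq hZ hx hG, inner_gradient_rhs, qpFormula,
    WithLp.ofLp_add, dotProduct_add, dotProduct_smul, smul_eq_mul, add_assoc]

/-- On A the multiplier is zero since z ≥ 0; off A the second factor is strictly negative. The
equality case is what lets LaSalle's condition on the nominal loop be used. -/
theorem multiplier_mul_nonpos (hG : (G x).PosDef) (hΓ : S.IsCBFStabilizable E D h α k V G ν)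
    (hx : x ∈ sublevel D V ν ∩ constraintSet E h) :
    qpMultiplier (G x) (S.lieG h x) (S.barrierMargin h α k x) *
        (S.lieG V x ⬝ᵥ ((G x)⁻¹ *ᵥ S.lieG h x)) ≤ 0 ∧
    (qpMultiplier (G x) (S.lieG h x) (S.barrierMargin h α k x) *
        (S.lieG V x ⬝ᵥ ((G x)⁻¹ *ᵥ S.lieG h x)) = 0 →
      qpMultiplier (G x) (S.lieG h x) (S.barrierMargin h α k x) = 0) := by
  obtain ⟨A, -, hneg, hA⟩ := hΓ
  by_cases hxA : x ∈ A
  · simp [qpMultiplier_of_nonneg (hA x hxA)]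
  · have h1 := hneg x ⟨hx, hxA⟩
    exact ⟨mul_nonpos_of_nonneg_of_nonpos (qpMultiplier_nonneg hG _ _) h1.le,
      fun h2 => (mul_eq_zero.1 h2).resolve_right h1.ne⟩

theorem lieClosedLoop_nominal_nonpos (hV : S.IsLyapunovStabilizing D k V) (hx : x ∈ D) :
    S.lieClosedLoop V k x ≤ 0 := by
  rcases hV.decrease with hlt | hle
  · by_cases h0 : x = 0
    · rw [h0, lieClosedLoop, hV.equilibrium, inner_zero_right]
    · exact (hlt x hx h0).le
  · exact hle.1 x hx

theorem lieClosedLoop_qpControl_le (hZ : S.IsZCBF E h α)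
    (hGpos : ∀ x ∈ D ∩ E, (G x).PosDef) (hΓ : S.IsCBFStabilizable E D h α k V G ν)
    (hx : x ∈ sublevel D V ν ∩ constraintSet E h) :
    S.lieClosedLoop V (S.qpControl h α k G) x ≤ S.lieClosedLoop V k x := by
  have hG := hGpos x ⟨hx.1.1, hx.2.1⟩
  rw [S.lieClosedLoop_qpControl hZ hx.2.1 hG]
  linarith [(S.multiplier_mul_nonpos hG hΓ hx).1]

theorem lieClosedLoop_qpControl_nonpos (hZ : S.IsZCBF E h α) (hV : S.IsLyapunovStabilizing D k V)
    (hGpos : ∀ x ∈ D ∩ E, (G x).PosDef) (hΓ : S.IsCBFStabilizable E D h α k V G ν)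
    (hx : x ∈ sublevel D V ν ∩ constraintSet E h) :
    S.lieClosedLoop V (S.qpControl h α k G) x ≤ 0 :=
  (S.lieClosedLoop_qpControl_le hZ hGpos hΓ hx).trans
    (S.lieClosedLoop_nominal_nonpos hV hx.1.1)

/-- Where `V` is stationary along the closed loop, the quadratic program returns the nominal input
and `V` is stationary along the nominal closed loop. -/
theorem nominal_of_lieClosedLoop_qpControl_eq_zero (hZ : S.IsZCBF E h α)
    (hV : S.IsLyapunovStabilizing D k V)
    (hGpos : ∀ x ∈ D ∩ E, (G x).PosDef) (hΓ : S.IsCBFStabilizable E D h α k V G ν)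
    (hx : x ∈ sublevel D V ν ∩ constraintSet E h)
    (h0 : S.lieClosedLoop V (S.qpControl h α k G) x = 0) :
    S.closedLoop (S.qpControl h α k G) x = S.closedLoop k x ∧ S.lieClosedLoop V k x = 0 := by
  have hG := hGpos x ⟨hx.1.1, hx.2.1⟩
  have h1 := S.multiplier_mul_nonpos hG hΓ hx
  have h2 := S.lieClosedLoop_nominal_nonpos hV hx.1.1
  rw [S.lieClosedLoop_qpControl hZ hx.2.1 hG] at h0
  refine ⟨?_, by linarith [h1.1]⟩
  rw [closedLoop, closedLoop, S.qpControl_eq hZ hx.2.1 hG, qpFormula,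
    h1.2 (by linarith [h1.1]), zero_smul, WithLp.toLp_zero, add_zero]

/-! ### Continuity of the closed loop -/

theorem continuousOn_gradient {X : Type*} [NormedAddCommGroup X] [InnerProductSpace ℝ X]
    [CompleteSpace X] {φ : X → ℝ} {U : Set X} (hU : IsOpen U) (hφ : ContDiffOn ℝ 1 φ U) :
    ContinuousOn (gradient φ) U :=
  (InnerProductSpace.toDual ℝ X).symm.continuous.comp_continuousOn
    (hφ.continuousOn_fderiv_of_isOpen hU le_rfl)

theorem continuous_g : Continuous S.g :=
  continuous_matrix fun i j => (S.lipschitz_g i j).continuous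

theorem continuousOn_lieG {U : Set (EuclideanSpace ℝ (Fin n))} (hU : IsOpen U)
    (hh : ContDiffOn ℝ 1 h U) : ContinuousOn (S.lieG h) U :=
  continuousOn_iff_continuous_domRestrict.2 <|
    ((PiLp.continuous_ofLp 2 _).comp
      (continuousOn_iff_continuous_domRestrict.1 (continuousOn_gradient hU hh))).matrix_vecMul
      (S.continuous_g.comp continuous_subtype_val)

theorem continuousOn_closedLoop {U : Set (EuclideanSpace ℝ (Fin n))}
    {u : EuclideanSpace ℝ (Fin n) → EuclideanSpace ℝ (Fin m)} (hu : ContinuousOn u U) :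
    ContinuousOn (S.closedLoop u) U := by
  refine S.lipschitz_f.continuous.continuousOn.add
    ((PiLp.continuous_toLp 2 _).comp_continuousOn ?_)
  exact continuousOn_iff_continuous_domRestrict.2 <|
    (S.continuous_g.comp continuous_subtype_val).matrix_mulVec
      ((PiLp.continuous_ofLp 2 _).comp (continuousOn_iff_continuous_domRestrict.1 hu))

theorem barrierMargin_eq :
    S.barrierMargin h α k x = inner ℝ (gradient h x) (S.closedLoop k x) + α (h x) := by
  rw [closedLoop, inner_gradient_rhs, barrierMargin]

theorem continuousOn_barrierMargin (hZ : S.IsZCBF E h α) {U : Set (EuclideanSpace ℝ (Fin n))}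
    (hUE : U ⊆ E) (hk : ContinuousOn k U) : ContinuousOn (S.barrierMargin h α k) U := by
  have h1 : ContinuousOn (fun x => inner ℝ (gradient h x) (S.closedLoop k x)) U :=
    ContinuousOn.inner (𝕜 := ℝ) ((continuousOn_gradient hZ.isOpen hZ.contDiff).mono hUE)
      (S.continuousOn_closedLoop hk)
  have h2 : ContinuousOn (fun x => α (h x)) U :=
    hZ.classK.lipschitz.continuous.comp_continuousOn (hZ.contDiff.continuousOn.mono hUE)
  exact (h1.add h2).congr fun x _ => S.barrierMargin_eq

theorem continuousOn_inv_posDef {X : Type*} [TopologicalSpace X] {U : Set X}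
    {P : X → Matrix (Fin m) (Fin m) ℝ} (hP : ContinuousOn P U) (hpos : ∀ x ∈ U, (P x).PosDef) :
    ContinuousOn (fun x => (P x)⁻¹) U := by
  simp only [Matrix.inv_def, Ring.inverse_eq_inv']
  have hc := continuousOn_iff_continuous_domRestrict.1 hP
  refine ContinuousOn.smul (ContinuousOn.inv₀ ?_ fun x hx => (hpos x hx).det_pos.ne') ?_
  · exact continuousOn_iff_continuous_domRestrict.2 hc.matrix_det
  · exact continuousOn_iff_continuous_domRestrict.2 hc.matrix_adjugate

/-- The set of points of `D ∩ E` where `L_g h ≠ 0` or the nominal input is strictly feasible. -/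
def regularSet (E D : Set (EuclideanSpace ℝ (Fin n)))
    (h : EuclideanSpace ℝ (Fin n) → ℝ) (α : ℝ → ℝ)
    (k : EuclideanSpace ℝ (Fin n) → EuclideanSpace ℝ (Fin m)) :
    Set (EuclideanSpace ℝ (Fin n)) :=
  {x ∈ D ∩ E | S.lieG h x ≠ 0 ∨ 0 < S.barrierMargin h α k x}

theorem isOpen_regularSet (hZ : S.IsZCBF E h α) (hD : IsOpen D) (hk : ContinuousOn k D) :
    IsOpen (S.regularSet E D h α k) := by
  have hO := hD.inter hZ.isOpen
  have h1 : IsOpen ((D ∩ E) ∩ S.lieG h ⁻¹' {0}ᶜ) :=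
    ((S.continuousOn_lieG hZ.isOpen hZ.contDiff).mono inter_subset_right).isOpen_inter_preimage hO
      isOpen_compl_singleton
  have h2 : IsOpen ((D ∩ E) ∩ S.barrierMargin h α k ⁻¹' Ioi 0) :=
    (S.continuousOn_barrierMargin hZ inter_subset_right
      (hk.mono inter_subset_left)).isOpen_inter_preimage hO isOpen_Ioi
  convert h1.union h2 using 1
  rw [← inter_union_distrib_left]
  rfl

/-- Where L_g h ≠ 0 the denominator of the multiplier is nonzero; where z > 0 the controller equals
k nearby, even if L_g h vanishes. -/
theorem continuousOn_closedLoop_qpControl (hZ : S.IsZCBF E h α) (hD : IsOpen D)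
    (hk : ContinuousOn k D) (hGc : ContinuousOn G (D ∩ E)) (hGpos : ∀ x ∈ D ∩ E, (G x).PosDef) :
    ContinuousOn (S.closedLoop (S.qpControl h α k G)) (S.regularSet E D h α k) := by
  have hO := hD.inter hZ.isOpen
  have hkO : ContinuousOn k (D ∩ E) := hk.mono inter_subset_left
  have hzc := S.continuousOn_barrierMargin hZ inter_subset_right hkO
  have hbc : ContinuousOn (S.lieG h) (D ∩ E) :=
    (S.continuousOn_lieG hZ.isOpen hZ.contDiff).mono inter_subset_right
  have hvc : ContinuousOn (fun x => (G x)⁻¹ *ᵥ S.lieG h x) (D ∩ E) :=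
    continuousOn_iff_continuous_domRestrict.2 <|
      (continuousOn_iff_continuous_domRestrict.1 (continuousOn_inv_posDef hGc hGpos)).matrix_mulVec
        (continuousOn_iff_continuous_domRestrict.1 hbc)
  have hqc : ContinuousOn (fun x => S.lieG h x ⬝ᵥ ((G x)⁻¹ *ᵥ S.lieG h x)) (D ∩ E) :=
    continuousOn_iff_continuous_domRestrict.2 <|
      (continuousOn_iff_continuous_domRestrict.1 hbc).dotProduct
        (continuousOn_iff_continuous_domRestrict.1 hvc)
  suffices hu : ContinuousOn (S.qpFormula h α k G) (S.regularSet E D h α k) from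
    (S.continuousOn_closedLoop hu).congr fun x hx => by
      rw [closedLoop, closedLoop, S.qpControl_eq hZ hx.1.2 (hGpos x hx.1)]
  intro x hx
  refine ContinuousAt.continuousWithinAt ?_
  have hnhds := hO.mem_nhds hx.1
  have hkx := hkO.continuousAt hnhds
  rcases hx.2 with hb | hz
  · refine hkx.add ((PiLp.continuous_toLp 2 _).continuousAt.comp ?_)
    refine ContinuousAt.smul (ContinuousAt.div₀ ?_ (hqc.continuousAt hnhds)
      ((hGpos x hx.1).dotProduct_inv_mulVec_pos hb).ne') (hvc.continuousAt hnhds)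
    exact continuousAt_const.max (hzc.continuousAt hnhds).neg
  · refine hkx.congr ?_
    filter_upwards [(hzc.continuousAt hnhds).eventually (lt_mem_nhds hz)] with y hy
    exact (S.qpFormula_of_margin_nonneg hy.le).symm

theorem barrierMargin_pos_of_gradient_eq_zero (hα : IsExtendedClassK α) (hx : 0 < h x)
    (hgrad : gradient h x = 0) : 0 < S.barrierMargin h α k x := by
  rw [barrierMargin_eq, hgrad, inner_zero_left, zero_add, ← hα.map_zero]
  exact hα.strictMono hx

/-- At a zero of L_g h allowed by the regularity condition, ∇h = 0 reduces z to α(h) > 0. -/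
theorem mem_regularSet (hZ : S.IsZCBF E h α) (hreg : S.IsRegularOn E h (sublevel D V ν))
    (hx : x ∈ sublevel D V ν ∩ E) : x ∈ S.regularSet E D h α k := by
  refine ⟨⟨hx.1.1, hx.2⟩, ?_⟩
  rcases hreg with hne | hcrit
  · exact Or.inl (hne x hx)
  · by_cases hb : S.lieG h x = 0
    · obtain ⟨hpos, hgrad⟩ := hcrit x hx hb
      exact Or.inr (S.barrierMargin_pos_of_gradient_eq_zero hZ.classK hpos.2 hgrad)
    · exact Or.inl hb

end ControlAffineSystem

/-! ### Functions along solutions -/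

theorem exists_first_hit {φ : ℝ → ℝ} {a b c : ℝ} (hab : a ≤ b) (hφ : ContinuousOn φ (Icc a b))
    (ha : φ a < c) (hb : c ≤ φ b) : ∃ t ∈ Ioc a b, φ t = c ∧ ∀ s ∈ Ico a t, φ s < c := by
  have hcomp : IsCompact (Icc a b ∩ φ ⁻¹' Ici c) :=
    isCompact_Icc.of_isClosed_subset (hφ.preimage_isClosed_of_isClosed isClosed_Icc isClosed_Ici)
      inter_subset_left
  obtain ⟨t, ht, hleast⟩ := hcomp.exists_isLeast ⟨b, right_mem_Icc.2 hab, hb⟩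
  have hlt : ∀ s ∈ Ico a t, φ s < c := by
    intro s hs
    by_contra! hcon
    exact absurd (hleast ⟨⟨hs.1, hs.2.le.trans ht.1.2⟩, hcon⟩) (not_le.2 hs.2)
  have hat : a < t := by
    rcases ht.1.1.eq_or_lt with h | h
    · exact absurd ha (not_lt.2 (by rw [h]; exact ht.2))
    · exact h
  obtain ⟨s, hs, hsc⟩ := intermediate_value_Icc ht.1.1
    (hφ.mono (Icc_subset_Icc_right ht.1.2)) ⟨ha.le, ht.2⟩
  rcases hs.2.eq_or_lt with rfl | hst
  · exact ⟨s, ⟨hat, ht.1.2⟩, hsc, hlt⟩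
  · exact absurd hsc (hlt s ⟨hs.1, hst⟩).ne

theorem HasDerivWithinAt.antitoneOn_of_nonpos {φ φ' : ℝ → ℝ} {I J : Set ℝ} (hJ : Convex ℝ J)
    (hJI : J ⊆ I) (hφ : ∀ t ∈ I, HasDerivWithinAt φ (φ' t) I t) (hd : ∀ t ∈ interior J, φ' t ≤ 0) :
    AntitoneOn φ J :=
  antitoneOn_of_hasDerivWithinAt_nonpos hJ ((HasDerivWithinAt.continuousOn hφ).mono hJI)
    (fun t ht => (hφ t (hJI (interior_subset ht))).mono (interior_subset.trans hJI)) hd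

/-- Up to its first hit of c the function is nonincreasing. The strict start matters: from φ a = c
it could leave with zero derivative. -/
theorem lt_of_forall_deriv_nonpos_of_le {φ φ' : ℝ → ℝ} {a T c : ℝ}
    (hφ : ∀ t ∈ Ico a T, HasDerivWithinAt φ (φ' t) (Ico a T) t) (ha : φ a < c)
    (hd : ∀ t ∈ Ico a T, φ t ≤ c → φ' t ≤ 0) : ∀ t ∈ Ico a T, φ t < c := by
  intro t ht
  by_contra! hcon
  obtain ⟨s, hs, hsc, hlt⟩ := exists_first_hit ht.1
    ((HasDerivWithinAt.continuousOn hφ).mono (Icc_subset_Ico_right ht.2)) ha hcon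
  have hanti : AntitoneOn φ (Icc a s) := by
    refine HasDerivWithinAt.antitoneOn_of_nonpos (convex_Icc a s)
      (Icc_subset_Ico_right (hs.2.trans_lt ht.2)) hφ fun τ hτ => ?_
    rw [interior_Icc] at hτ
    exact hd τ ⟨hτ.1.le, hτ.2.trans (hs.2.trans_lt ht.2)⟩ (hlt τ ⟨hτ.1.le, hτ.2⟩).le
  have := hanti (left_mem_Icc.2 hs.1.le) (right_mem_Icc.2 hs.1.le) hs.1.le
  linarith

/-- After its last nonnegative time before t, φ is nondecreasing. The sign is known on the bad side
here, so starting at 0 is harmless. -/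
theorem nonneg_of_forall_deriv_nonneg_of_neg {φ φ' : ℝ → ℝ} {a T : ℝ}
    (hφ : ∀ t ∈ Ico a T, HasDerivWithinAt φ (φ' t) (Ico a T) t) (ha : 0 ≤ φ a)
    (hd : ∀ t ∈ Ico a T, φ t < 0 → 0 ≤ φ' t) : ∀ t ∈ Ico a T, 0 ≤ φ t := by
  intro t ht
  by_contra! hcon
  have hc : ContinuousOn φ (Ico a T) := HasDerivWithinAt.continuousOn hφ
  have hcomp : IsCompact (Icc a t ∩ φ ⁻¹' Ici 0) :=
    isCompact_Icc.of_isClosed_subset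
      ((hc.mono (Icc_subset_Ico_right ht.2)).preimage_isClosed_of_isClosed isClosed_Icc isClosed_Ici)
      inter_subset_left
  obtain ⟨s, hs, hgr⟩ := hcomp.exists_isGreatest ⟨a, left_mem_Icc.2 ht.1, ha⟩
  have hsub : Icc s t ⊆ Ico a T := fun τ hτ => ⟨hs.1.1.trans hτ.1, hτ.2.trans_lt ht.2⟩
  have hmono : MonotoneOn φ (Icc s t) := by
    refine monotoneOn_of_hasDerivWithinAt_nonneg (convex_Icc s t) (hc.mono hsub) (f' := φ')
      (fun τ hτ => (hφ τ (hsub (interior_subset hτ))).mono (interior_subset.trans hsub))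
      fun τ hτ => hd τ (hsub (interior_subset hτ)) ?_
    rw [interior_Icc] at hτ
    by_contra! hτ0
    exact absurd (hgr ⟨⟨hs.1.1.trans hτ.1.le, hτ.2.le⟩, hτ0⟩) (not_le.2 hτ.1)
  have h1 := hmono (left_mem_Icc.2 hs.1.2) (right_mem_Icc.2 hs.1.2) hs.1.2
  have h2 : 0 ≤ φ s := hs.2
  linarith

theorem exists_lt_of_deriv_neg {φ : ℝ → ℝ} {d a t T : ℝ} (hat : a < t) (htT : t ≤ T)
    (hφ : HasDerivWithinAt φ d (Ico a T) a) (hd : d < 0) : ∃ s ∈ Ioo a t, φ s < φ a := by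
  rw [hasDerivWithinAt_iff_tendsto_slope] at hφ
  have hle : 𝓝[>] a ≤ 𝓝[Ico a T \ {a}] a := by
    rw [← nhdsWithin_Ioo_eq_nhdsGT hat]
    exact nhdsWithin_mono a fun s hs => ⟨⟨hs.1.le, hs.2.trans_le htT⟩, hs.1.ne'⟩
  obtain ⟨s, hs, hst⟩ := (((hφ.mono_left hle).eventually (gt_mem_nhds hd)).and
    (Ioo_mem_nhdsGT hat)).exists
  refine ⟨s, hst, ?_⟩
  rw [slope_def_field, div_neg_iff] at hs
  rcases hs with hs | hs
  · linarith [hs.2, hst.1]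
  · linarith [hs.1]

theorem IsSolutionOn.mono {n : ℕ} {F : EuclideanSpace ℝ (Fin n) → EuclideanSpace ℝ (Fin n)}
    {Ω : Set (EuclideanSpace ℝ (Fin n))} {I J : Set ℝ} {x : ℝ → EuclideanSpace ℝ (Fin n)}
    (hx : IsSolutionOn F Ω I x) (hJ : J ⊆ I) : IsSolutionOn F Ω J x :=
  fun t ht => ⟨(hx t (hJ ht)).1, (hx t (hJ ht)).2.mono hJ⟩

/-- The derivative of a continuously differentiable function along a solution. -/
theorem IsSolutionOn.hasDerivWithinAt_comp {n : ℕ}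
    {F : EuclideanSpace ℝ (Fin n) → EuclideanSpace ℝ (Fin n)}
    {Ω U : Set (EuclideanSpace ℝ (Fin n))} {I : Set ℝ} {x : ℝ → EuclideanSpace ℝ (Fin n)}
    {φ : EuclideanSpace ℝ (Fin n) → ℝ} (hx : IsSolutionOn F Ω I x) (hU : IsOpen U) (hΩU : Ω ⊆ U)
    (hφ : ContDiffOn ℝ 1 φ U) :
    ∀ t ∈ I, HasDerivWithinAt (fun t => φ (x t)) (inner ℝ (gradient φ (x t)) (F (x t))) I t := by
  intro t ht
  have hd : DifferentiableAt ℝ φ (x t) :=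
    (hφ.contDiffAt (hU.mem_nhds (hΩU (hx t ht).1))).differentiableAt one_ne_zero
  exact hd.hasGradientAt.hasFDerivAt.comp_hasDerivWithinAt t (hx t ht).2

/-! ### Invariance, convergence and stability for the closed loop -/

namespace ControlAffineSystem

variable {n m : ℕ} (S : ControlAffineSystem n m) {E D : Set (EuclideanSpace ℝ (Fin n))}
  {h V : EuclideanSpace ℝ (Fin n) → ℝ} {α : ℝ → ℝ}
  {k : EuclideanSpace ℝ (Fin n) → EuclideanSpace ℝ (Fin m)}
  {G : EuclideanSpace ℝ (Fin n) → Matrix (Fin m) (Fin m) ℝ} {ν : ℝ}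

/-- The constraint set is forward invariant. -/
theorem constraintSet_invariant (hZ : S.IsZCBF E h α) (hGpos : ∀ x ∈ D ∩ E, (G x).PosDef) {T : ℝ}
    {x : ℝ → EuclideanSpace ℝ (Fin n)}
    (hx : IsSolutionOn (S.closedLoop (S.qpControl h α k G)) (D ∩ E) (Ico 0 T) x)
    (hx0 : 0 ≤ h (x 0)) : ∀ t ∈ Ico 0 T, x t ∈ constraintSet E h := by
  intro t ht
  refine ⟨(hx t ht).1.2, nonneg_of_forall_deriv_nonneg_of_neg
    (hx.hasDerivWithinAt_comp hZ.isOpen inter_subset_right hZ.contDiff) hx0 (fun s hs hneg => ?_)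
    t ht⟩
  -- The program is feasible outside 𝒞 too, so ḣ ≥ -α(h) > 0 where h < 0.
  have h1 := S.neg_le_lieClosedLoop_qpControl (k := k) hZ (hx s hs).1.2 (hGpos _ (hx s hs).1)
  have h2 := hZ.classK.strictMono hneg
  rw [hZ.classK.map_zero] at h2
  linarith

/-- Solutions stay in the intersection of the sublevel set and the constraint set. -/
theorem sublevel_inter_constraintSet_invariant (hZ : S.IsZCBF E h α)
    (hV : S.IsLyapunovStabilizing D k V) (hGpos : ∀ x ∈ D ∩ E, (G x).PosDef)
    (hΓ : S.IsCBFStabilizable E D h α k V G ν) {T : ℝ} {x : ℝ → EuclideanSpace ℝ (Fin n)}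
    (hx : IsSolutionOn (S.closedLoop (S.qpControl h α k G)) (D ∩ E) (Ico 0 T) x)
    (hx0 : x 0 ∈ sublevel D V ν ∩ constraintSet E h)
    (hstrict : V (x 0) = ν → S.lieClosedLoop V k (x 0) < 0) :
    ∀ t ∈ Ico 0 T, x t ∈ sublevel D V ν ∩ constraintSet E h := by
  have hC := S.constraintSet_invariant hZ hGpos hx hx0.2.2
  have hder := hx.hasDerivWithinAt_comp hV.isOpen inter_subset_left hV.contDiff
  have hnonpos : ∀ t ∈ Ico 0 T, V (x t) ≤ ν →
      inner ℝ (gradient V (x t)) (S.closedLoop (S.qpControl h α k G) (x t)) ≤ 0 := fun t ht hν =>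
    S.lieClosedLoop_qpControl_nonpos hZ hV hGpos hΓ ⟨⟨(hx t ht).1.1, hν⟩, hC t ht⟩
  intro t ht
  refine ⟨⟨(hx t ht).1.1, ?_⟩, hC t ht⟩
  rcases hx0.1.2.lt_or_eq with hlt | heq
  · exact (lt_of_forall_deriv_nonpos_of_le hder hlt hnonpos t ht).le
  · rcases ht.1.eq_or_lt with rfl | ht0
    · exact hx0.1.2
    · have h0 : (0 : ℝ) ∈ Ico 0 T := ⟨le_rfl, ht0.trans ht.2⟩
      -- From the level V = ν, the strict decrease brings V below ν at arbitrarily small times s;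
      -- the strict case applies from s on.
      obtain ⟨s, hs, hsν⟩ := exists_lt_of_deriv_neg ht0 ht.2.le (hder 0 h0)
        ((S.lieClosedLoop_qpControl_le hZ hGpos hΓ hx0).trans_lt (hstrict heq))
      have hsub : Ico s T ⊆ Ico 0 T := Ico_subset_Ico_left hs.1.le
      rw [heq] at hsν
      exact (lt_of_forall_deriv_nonpos_of_le (fun τ hτ => (hder τ (hsub hτ)).mono hsub) hsν
        (fun τ hτ => hnonpos τ (hsub hτ)) t ⟨hs.2.le, ht.2⟩).le

/-- Solutions in `Γ_ν ∩ 𝒞` along which `V` is constant start at the origin. -/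
theorem eq_zero_of_lyapunov_const (hZ : S.IsZCBF E h α)
    (hV : S.IsLyapunovStabilizing D k V) (hGpos : ∀ x ∈ D ∩ E, (G x).PosDef)
    (hΓ : S.IsCBFStabilizable E D h α k V G ν) {y : ℝ → EuclideanSpace ℝ (Fin n)}
    (hy : IsSolutionOn (S.closedLoop (S.qpControl h α k G))
      (sublevel D V ν ∩ constraintSet E h) (Ici 0) y)
    (hconst : ∀ t ∈ Ici (0 : ℝ), V (y t) = V (y 0)) : y 0 = 0 := by
  have hnom : ∀ t ∈ Ici (0 : ℝ), S.closedLoop (S.qpControl h α k G) (y t) = S.closedLoop k (y t) ∧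
      S.lieClosedLoop V k (y t) = 0 := by
    intro t ht
    refine S.nominal_of_lieClosedLoop_qpControl_eq_zero hZ hV hGpos hΓ (hy t ht).1 ?_
    have h1 := hy.hasDerivWithinAt_comp hV.isOpen (fun p hp => hp.1.1) hV.contDiff t ht
    have h2 : HasDerivWithinAt (fun t => V (y t)) 0 (Ici 0) t :=
      (hasDerivWithinAt_const t (Ici 0) (V (y 0))).congr hconst (hconst t ht)
    exact (uniqueDiffOn_Ici 0 t ht).eq_deriv _ h1 h2
  rcases hV.decrease with hlt | ⟨-, hLS⟩
  · by_contra hne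
    exact (hlt _ (hy 0 self_mem_Ici).1.1.1 hne).ne (hnom 0 self_mem_Ici).2
  · refine hLS y (fun t ht => ⟨⟨(hy t ht).1.1.1, (hnom t ht).2⟩, ?_⟩) 0 le_rfl
    rw [← (hnom t ht).1]
    exact (hy t ht).2

/-- Solutions that are trapped in a compact part of `Γ_ν ∩ 𝒞` exist for all times and converge to
the origin. -/
theorem forwardComplete_and_tendsto_of_trapped (hZ : S.IsZCBF E h α)
    (hV : S.IsLyapunovStabilizing D k V)
    (hGlip : ∀ i j, LocallyLipschitzOn (D ∩ E) fun x => G x i j)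
    (hGpos : ∀ x ∈ D ∩ E, (G x).PosDef)
    (hΓ : S.IsCBFStabilizable E D h α k V G ν) (hreg : S.IsRegularOn E h (sublevel D V ν))
    {K : Set (EuclideanSpace ℝ (Fin n))} (hK : IsCompact K)
    (hKΓ : K ⊆ sublevel D V ν ∩ constraintSet E h) {x₀ : EuclideanSpace ℝ (Fin n)} (hx₀ : x₀ ∈ K)
    (htrap : ∀ T : ℝ, 0 < T → ∀ x : ℝ → EuclideanSpace ℝ (Fin n),
      IsSolutionOn (S.closedLoop (S.qpControl h α k G)) (D ∩ E) (Ico 0 T) x → x 0 = x₀ →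
      ∀ t ∈ Ico 0 T, x t ∈ K) :
    ForwardComplete (S.closedLoop (S.qpControl h α k G)) (D ∩ E) x₀ ∧
    ∀ x : ℝ → EuclideanSpace ℝ (Fin n),
      IsSolutionOn (S.closedLoop (S.qpControl h α k G)) (D ∩ E) (Ici 0) x → x 0 = x₀ →
      (∀ t, 0 ≤ t → x t ∈ K) ∧ Tendsto x atTop (𝓝 0) := by
  have hk : ContinuousOn k D := hV.lipschitz.continuousOn
  have hGc : ContinuousOn G (D ∩ E) :=
    continuousOn_pi.2 fun i => continuousOn_pi.2 fun j => (hGlip i j).continuousOn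
  have hKU : K ⊆ S.regularSet E D h α k := fun p hp =>
    S.mem_regularSet hZ hreg ⟨(hKΓ hp).1, (hKΓ hp).2.1⟩
  have hF := S.continuousOn_closedLoop_qpControl hZ hV.isOpen hk hGc hGpos
  refine ⟨forwardComplete_of_trapped (S.isOpen_regularSet hZ hV.isOpen hk) (fun p hp => hp.1) hKU
    hK hF hx₀ htrap, fun x hx hx0 => ?_⟩
  have hxK : ∀ t, 0 ≤ t → x t ∈ K := fun t ht =>
    htrap (t + 1) (by linarith) x (hx.mono Ico_subset_Ici_self) hx0 t ⟨ht, by linarith⟩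
  refine ⟨hxK, tendsto_of_antitone_of_compact hK (hF.mono hKU)
    (hV.contDiff.continuousOn.mono fun p hp => (hKΓ hp).1.1)
    (fun t ht => ⟨hxK t ht, (hx t ht).2⟩) ?_ fun y hy hconst => ?_⟩
  · exact HasDerivWithinAt.antitoneOn_of_nonpos (convex_Ici 0) subset_rfl
      (hx.hasDerivWithinAt_comp hV.isOpen inter_subset_left hV.contDiff) fun t ht =>
        S.lieClosedLoop_qpControl_nonpos hZ hV hGpos hΓ (hKΓ (hxK t (interior_subset ht)))
  · exact S.eq_zero_of_lyapunov_const hZ hV hGpos hΓ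
      (fun t ht => ⟨hKΓ (hy t ht).1, (hy t ht).2⟩) hconst

/-- Solutions that start close to the origin are trapped in a small ball inside `Γ_ν ∩ 𝒞`. -/
theorem exists_trapping_closedBall (hZ : S.IsZCBF E h α)
    (h0 : (0 : EuclideanSpace ℝ (Fin n)) ∈ constraintInterior E h)
    (hV : S.IsLyapunovStabilizing D k V) (hGpos : ∀ x ∈ D ∩ E, (G x).PosDef) (hν : 0 < ν)
    (hΓ : S.IsCBFStabilizable E D h α k V G ν) {ε : ℝ} (hε : 0 < ε) :
    ∃ r < ε, Metric.closedBall 0 r ⊆ sublevel D V ν ∩ constraintSet E h ∧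
      ∃ δ > 0, ∀ x₀ : EuclideanSpace ℝ (Fin n), ‖x₀‖ < δ → x₀ ∈ Metric.closedBall 0 r ∧
        ∀ T : ℝ, 0 < T → ∀ x : ℝ → EuclideanSpace ℝ (Fin n),
          IsSolutionOn (S.closedLoop (S.qpControl h α k G)) (D ∩ E) (Ico 0 T) x → x 0 = x₀ →
          ∀ t ∈ Ico 0 T, x t ∈ Metric.closedBall 0 r := by
  have hVc : ContinuousAt V 0 :=
    hV.contDiff.continuousOn.continuousAt (hV.isOpen.mem_nhds hV.zero_mem)
  have hhc : ContinuousAt h 0 := hZ.contDiff.continuousOn.continuousAt (hZ.isOpen.mem_nhds h0.1)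
  have hV0 : ∀ c, 0 < c → ∀ᶠ x in 𝓝 0, V x < c := fun c hc =>
    hVc.eventually (gt_mem_nhds (by rwa [hV.map_zero]))
  have hnear : sublevel D V ν ∩ constraintSet E h ∈ 𝓝 (0 : EuclideanSpace ℝ (Fin n)) := by
    filter_upwards [hV.isOpen.mem_nhds hV.zero_mem, hZ.isOpen.mem_nhds h0.1, hV0 ν hν,
      hhc.eventually (lt_mem_nhds h0.2)] with x h1 h2 h3 h4
    exact ⟨⟨h1, h3.le⟩, ⟨h2, h4.le⟩⟩
  obtain ⟨r₀, hr₀, hball⟩ := Metric.nhds_basis_closedBall.mem_iff.1 hnear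
  obtain ⟨r, hr, hr0⟩ := exists_between (lt_min hr₀ hε)
  have hsub : Metric.closedBall 0 r ⊆ sublevel D V ν ∩ constraintSet E h :=
    (Metric.closedBall_subset_closedBall (hr0.le.trans (min_le_left _ _))).trans hball
  -- A positive lower bound for V on the sphere of radius r; for n = 0 the sphere is empty and c is
  -- still positive.
  obtain ⟨c, hc, hcV⟩ := (isCompact_sphere (0 : EuclideanSpace ℝ (Fin n)) r).exists_forall_le'
    (f := V) (a := 0)
    (hV.contDiff.continuousOn.mono fun p hp => (hsub (Metric.sphere_subset_closedBall hp)).1.1)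
    (fun p hp => hV.pos p (hsub (Metric.sphere_subset_closedBall hp)).1.1
      (Metric.ne_of_mem_sphere hp hr.ne'))
  obtain ⟨δ, hδ, hδc⟩ := Metric.nhds_basis_ball.mem_iff.1
    ((hV0 c hc).and (Metric.ball_mem_nhds (0 : EuclideanSpace ℝ (Fin n)) hr))
  refine ⟨r, hr0.trans_le (min_le_right _ _), hsub, δ, hδ, fun x₀ hx₀ => ?_⟩
  obtain ⟨hVx₀, hrx₀⟩ := hδc (mem_ball_zero_iff.2 hx₀)
  refine ⟨Metric.ball_subset_closedBall hrx₀, ?_⟩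
  rintro T hT x hx rfl t ht
  by_contra hcon
  rw [mem_closedBall_zero_iff, not_le] at hcon
  rw [dist_zero_right] at hrx₀
  have hxc : ContinuousOn x (Ico 0 T) := HasDerivWithinAt.continuousOn fun t ht => (hx t ht).2
  -- Before first reaching the sphere, the solution lies in Γ_ν ∩ 𝒞, where V does not increase, so V
  -- stays below c.
  obtain ⟨s, hs, hsr, hlt⟩ := exists_first_hit ht.1
    ((hxc.mono (Icc_subset_Ico_right ht.2)).norm) hrx₀ hcon.le
  have hanti : AntitoneOn (fun t => V (x t)) (Icc 0 s) := by
    refine HasDerivWithinAt.antitoneOn_of_nonpos (convex_Icc 0 s)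
      (Icc_subset_Ico_right (hs.2.trans_lt ht.2))
      (hx.hasDerivWithinAt_comp hV.isOpen inter_subset_left hV.contDiff) fun τ hτ => ?_
    rw [interior_Icc] at hτ
    exact S.lieClosedLoop_qpControl_nonpos hZ hV hGpos hΓ
      (hsub (mem_closedBall_zero_iff.2 (hlt τ ⟨hτ.1.le, hτ.2⟩).le))
  have h1 : V (x s) ≤ V (x 0) :=
    hanti (left_mem_Icc.2 hs.1.le) (right_mem_Icc.2 hs.1.le) hs.1.le
  have h2 : V (x 0) < c := hVx₀
  linarith [hcV (x s) (mem_sphere_zero_iff_norm.2 hsr)]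

/-- At the nominal equilibrium z = α(h(0)) > 0, so the constraint is inactive. -/
theorem closedLoop_qpControl_zero (hZ : S.IsZCBF E h α)
    (h0 : (0 : EuclideanSpace ℝ (Fin n)) ∈ constraintInterior E h)
    (hk0 : S.closedLoop k 0 = 0) (hG0 : (G 0).PosDef) :
    S.closedLoop (S.qpControl h α k G) 0 = 0 := by
  have hz : 0 ≤ S.barrierMargin h α k 0 := by
    rw [barrierMargin_eq, hk0, inner_zero_right, zero_add, ← hZ.classK.map_zero]
    exact (hZ.classK.strictMono h0.2).le
  rw [closedLoop, S.qpControl_eq hZ h0.1 hG0, S.qpFormula_of_margin_nonneg hz]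
  exact hk0

theorem isAsymptoticallyStable_closedLoop_qpControl (hZ : S.IsZCBF E h α)
    (h0 : (0 : EuclideanSpace ℝ (Fin n)) ∈ constraintInterior E h)
    (hV : S.IsLyapunovStabilizing D k V)
    (hGlip : ∀ i j, LocallyLipschitzOn (D ∩ E) fun x => G x i j)
    (hGpos : ∀ x ∈ D ∩ E, (G x).PosDef) (hν : 0 < ν)
    (hΓ : S.IsCBFStabilizable E D h α k V G ν) (hreg : S.IsRegularOn E h (sublevel D V ν)) :
    IsAsymptoticallyStable (S.closedLoop (S.qpControl h α k G)) (D ∩ E) where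
  mem := ⟨hV.zero_mem, h0.1⟩
  equilibrium :=
    S.closedLoop_qpControl_zero hZ h0 hV.equilibrium (hGpos 0 ⟨hV.zero_mem, h0.1⟩)
  stable := by
    intro ε hε
    obtain ⟨r, hr, hsub, δ, hδ, htrap⟩ := S.exists_trapping_closedBall hZ h0 hV hGpos hν hΓ hε
    refine ⟨δ, hδ, fun x₀ hx₀ => ?_⟩
    obtain ⟨hfc, hconv⟩ := S.forwardComplete_and_tendsto_of_trapped hZ hV hGlip hGpos hΓ hreg
      (isCompact_closedBall 0 r) hsub (htrap x₀ hx₀).1 (htrap x₀ hx₀).2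
    exact ⟨hfc, fun x hx hx0 t ht =>
      (mem_closedBall_zero_iff.1 ((hconv x hx hx0).1 t ht)).trans_lt hr⟩
  attractive := by
    obtain ⟨r, -, hsub, δ, hδ, htrap⟩ :=
      S.exists_trapping_closedBall hZ h0 hV hGpos hν hΓ one_pos
    exact ⟨δ, hδ, fun x₀ hx₀ x hx hx0 =>
      ((S.forwardComplete_and_tendsto_of_trapped hZ hV hGlip hGpos hΓ hreg
        (isCompact_closedBall 0 r) hsub (htrap x₀ hx₀).1 (htrap x₀ hx₀).2).2 x hx hx0).2⟩

end ControlAffineSystem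

theorem mainTheorem1 {n m : ℕ} (S : ControlAffineSystem n m)
    (E : Set (EuclideanSpace ℝ (Fin n))) (h : EuclideanSpace ℝ (Fin n) → ℝ) (α : ℝ → ℝ)
    (hZ : S.IsZCBF E h α) (h0 : (0 : EuclideanSpace ℝ (Fin n)) ∈ constraintInterior E h)
    (D : Set (EuclideanSpace ℝ (Fin n)))
    (k : EuclideanSpace ℝ (Fin n) → EuclideanSpace ℝ (Fin m))
    (V : EuclideanSpace ℝ (Fin n) → ℝ)
    (hV : S.IsLyapunovStabilizing D k V)
    (G : EuclideanSpace ℝ (Fin n) → Matrix (Fin m) (Fin m) ℝ)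
    (hGlip : ∀ i j, LocallyLipschitzOn (D ∩ E) fun x => G x i j)
    (hGpos : ∀ x ∈ D ∩ E, (G x).PosDef)
    (ν : ℝ) (hν : 0 < ν)
    (hΓ : S.IsCBFStabilizable E D h α k V G ν)
    (hreg : S.IsRegularOn E h (sublevel D V ν)) :
    -- the quadratic program defines the controller
    (∀ x ∈ D ∩ E, ∃! u, S.IsQPSolution h α k G x u) ∧
    -- solutions stay in `Γ_ν ∩ 𝒞` as long as they exist
    (∀ x₀ ∈ sublevel D V ν ∩ constraintSet E h,
      (V x₀ = ν → S.lieClosedLoop V k x₀ < 0) →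
      ∀ T : ℝ, 0 < T → ∀ x : ℝ → EuclideanSpace ℝ (Fin n),
        IsSolutionOn (S.closedLoop (S.qpControl h α k G)) (D ∩ E) (Ico 0 T) x → x 0 = x₀ →
        ∀ t ∈ Ico 0 T, x t ∈ sublevel D V ν ∩ constraintSet E h) ∧
    -- the origin is asymptotically stable
    IsAsymptoticallyStable (S.closedLoop (S.qpControl h α k G)) (D ∩ E) ∧
    -- for compact `Γ_ν ∩ 𝒞`, solutions exist and stay there for all `t ≥ 0`, and converge to `0`
    (IsCompact (sublevel D V ν ∩ constraintSet E h) →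
      ∀ x₀ ∈ sublevel D V ν ∩ constraintSet E h,
        (V x₀ = ν → S.lieClosedLoop V k x₀ < 0) →
        ForwardComplete (S.closedLoop (S.qpControl h α k G)) (D ∩ E) x₀ ∧
        ∀ x : ℝ → EuclideanSpace ℝ (Fin n),
          IsSolutionOn (S.closedLoop (S.qpControl h α k G)) (D ∩ E) (Ici 0) x → x 0 = x₀ →
          (∀ t, 0 ≤ t → x t ∈ sublevel D V ν ∩ constraintSet E h) ∧
          Tendsto x atTop (𝓝 0)) := by
  refine ⟨fun x hx => ?_, ?_, ?_, ?_⟩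
  · have hiff := S.isQPSolution_iff (k := k) hZ hx.2 (hGpos x hx)
    exact ⟨_, (hiff _).2 rfl, fun u hu => (hiff u).1 hu⟩
  · rintro x₀ hx₀ hstrict T - x hx rfl
    exact S.sublevel_inter_constraintSet_invariant hZ hV hGpos hΓ hx hx₀ hstrict
  · exact S.isAsymptoticallyStable_closedLoop_qpControl hZ h0 hV hGlip hGpos hν hΓ hreg
  · intro hK x₀ hx₀ hstrict
    refine S.forwardComplete_and_tendsto_of_trapped hZ hV hGlip hGpos hΓ hreg hK subset_rfl hx₀ ?_
    rintro T - x hx rfl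
    exact S.sublevel_inter_constraintSet_invariant hZ hV hGpos hΓ hx hx₀ hstrict
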